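/- **Arrays.** For integers $K,F\ge 1$, a $(K,F,Z,S)$ *secure placement delivery array* (SPDA) is an $F\times K$ array $P=(p_{j,k})$ with entries in $\{*\}\cup[0,S)$ such that (C1) $*$ appears exactly $Z$ times in each column; (C2) each $s\in[0,S)$ appears at least four times; (C3) for each $s\in[0,S)$ the rows and columns containing $s$ form, up to row and column permutations, a $(g+1)\times g$ array whose first row is constantly $s$ and whose remaining $g$ rows have $s$ on the diagonal and $*$ elsewhere. Write $\mathcal U_s$ for the set of columns containing $s$ and $j^{(s)}$ for the unique row containing $s$ at least twice. **Scheme of an SPDA.** There are $N\ge K$ files $W_n$, each consisting of $F$ packets $W_n(0),\dots,W_n(F-1)$ of $b\ge1$ bits, so $B=Fb$ bits per file. For each $n$ the server picks a permutation $\varphi_n$ of $[0,F)$; the packet $W_n(j)$ is shown to users under the label $(n,\varphi_n(j))$. There is one key $T_s\in\{0,1\}^b$ for each $s\in[0,S)$, and the demand vector $d=(d_0,\dots,d_{K-1})$ has pairwise different entries. Files, permutations, keys and demand vector are independent and uniform. User $k$ caches the set $\mathcal Z_k$ of all packets $W_n(j)$, with their labels, for which $p_{j,k}=*$, or $p_{j,k}=s$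 and $j=j^{(s)}$ for some $s$; it also caches the keys $\mathcal T_k=\{T_s: k\in\mathcal U_s\}$. For each $s$ the server broadcasts $T_s\oplus X_s$ with $$X_s=\bigoplus_{k\in\mathcal U_s,\ p_{j,k}=s,\ j\ne j^{(s)}}W_{d_k}(j)\ \oplus\bigoplus_{n\notin\{d_k:\,k\in\mathcal U_s\}}W_n(j^{(s)}),$$ together with a header $h_s$, the set of labels of the packets in $X_s$. The scheme is a *secure $F$-division $(K,M,N)$ coded caching scheme* if $0<M<N$; every user caches packets of total size $MB$ bits and exactly $F(1-M/N)$ keys; the groups $\mathcal U_s$ are pairwise different; and for every user $k$, with $d_{-k}=(d_l)_{l\ne k}$, * decoding: $H\big(W_{d_k}\mid \mathcal Z_k,\mathcal T_k,\{(h_s,T_s\oplus X_s):k\in\mathcal U_s\},\varphi_{d_k}\big)=0$; * demand privacy: $I\big(d_{-k};\{(h_s,X_s):k\in\mathcal U_s\}\mid \varphi_{d_k},\mathcal Z_k,d_k\big)=0$; * the bits (without labels) of the packets cached by $k$, the keys $\mathcal T_k$ and the signals $\{X_s:k\in\mathcal U_s\}$ are jointly independent of $(\varphi_n)_n$; * security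 against wiretappers: $I\big((W_n)_n;\{(h_s,T_s\oplus X_s): s\in[0,S)\}\big)=0$. Its subpacketization is $F$, its memory ratio is $M/N$ and its rate is $R=S/F$. **Theorem.** Let $K,t$ be positive integers with $(t+1)\nmid K$ and $\lfloor K/2\rfloor>t+1$, and let $K'$ be the least multiple of $t+1$ exceeding $K$. The $(t+1)$-subsets of $[0,K')$ can be partitioned into $\binom{K'-1}{t}$ parallel classes, each of which is a partition of $[0,K')$. For every such partition $\mathcal D_0,\mathcal D_1,\dots$, consider the array with columns $k\in[0,K)$ whose rows are the classes $\mathcal D_i$ together with the $t$-subsets $A$ of $[0,K)$. The entry in row $\mathcal D_i$ and column $k$ is the block $D\in\mathcal D_i$ with $k\in D$ if $D\subseteq[0,K)$, and $*$ otherwise; the entry in row $A$ and column $k$ is $A\cup\{k\}$ if $k\notin A$, and $*$ otherwise. After numbering the rows and the $(t+1)$-subsets of $[0,K)$ in any way, this is a $$\Big(K,\ \tbinom Kt+\tbinom{K'-1}t,\ \tbinom{K-1}{t-1}+\tbinom{K'-1}t-\tbinom{K-1}t,\ \tbinom K{t+1}\Big)$$ SPDA. For every $N\ge K$ and every $b\ge1$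 its scheme is a secure $(K,M,N)$ coded caching scheme with $$\frac MN=\frac{\binom{K-1}{t-1}+\binom{K'-1}t}{\binom Kt+\binom{K'-1}t},\qquad R=\frac{\binom K{t+1}}{\binom Kt+\binom{K'-1}t},$$ and subpacketization $\binom Kt+\binom{K'-1}t$. -/

import Mathlib

namespace SecureCaching

/-! ### Shannon quantities on a finite, uniformly distributed sample space -/

section Information

variable {Ω α β γ : Type*} [Fintype Ω]

open Classical in
/-- The probability that `X = a` when the sample point is uniform on `Ω`. -/
noncomputable def prob (X : Ω → α) (a : α) : ℝ :=
  ((Finset.univ.filter (fun ω => X ω = a)).card : ℝ) / (Fintype.card Ω : ℝ)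

open Classical in
/-- Shannon entropy `H(X)` (in nats); the sum runs over the values that `X` takes. -/
noncomputable def entropy (X : Ω → α) : ℝ :=
  ∑ a ∈ Finset.univ.image X, Real.negMulLog (prob X a)

/-- Conditional entropy `H(X | Y)`. -/
noncomputable def condEntropy (X : Ω → α) (Y : Ω → β) : ℝ :=
  entropy (fun ω => (X ω, Y ω)) - entropy Y

/-- Mutual information `I(X ; Y)`. -/
noncomputable def mutualInfo (X : Ω → α) (Y : Ω → β) : ℝ :=
  entropy X + entropy Y - entropy (fun ω => (X ω, Y ω))

/-- Conditional mutual information `I(X ; Y | Z)`. -/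
noncomputable def condMutualInfo (X : Ω → α) (Y : Ω → β) (Z : Ω → γ) : ℝ :=
  entropy (fun ω => (X ω, Z ω)) + entropy (fun ω => (Y ω, Z ω))
    - entropy (fun ω => (X ω, Y ω, Z ω)) - entropy Z

end Information

/-! ### Coded caching schemes -/

/-- The bit strings of length `b`; addition is XOR. -/
abbrev Bits (b : ℕ) : Type := Fin b → ZMod 2

/-- The combinatorial data of a coded caching scheme with `K` users, `N` files, `F` packets per file
and `S` coded signals. The pair `(n, j)` stands for the `j`-th packet of the file `n`; the label
under which the users see this packet is `φ_n(j)`, where `φ_n` is the server's secret permutation.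
Demand vectors are injective: all the requested files are different from each other. -/
structure Scheme (K N F S : ℕ) where
  /-- the packets placed into the cache of user `k` -/
  place : Fin K → Finset (Fin N × Fin F)
  /-- the group of users to which the `s`-th coded signal is addressed -/
  group : Fin S → Finset (Fin K)
  /-- the packets whose XOR is the `s`-th coded signal, for a given demand vector -/
  deliver : (Fin K ↪ Fin N) → Fin S → Finset (Fin N × Fin F)

/-- All the randomness of the system: the files (`F` packets of `b` bits each), the permutations,
the secret keys (one for each coded signal) and the demand vector. The uniform distribution on this
product makes these components independent and uniform. -/
abbrev Outcome (K N F S b : ℕ) : Type :=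
  (Fin N → Fin F → Bits b) × (Fin N → Equiv.Perm (Fin F)) × (Fin S → Bits b) × (Fin K ↪ Fin N)

namespace Outcome

variable {K N F S b : ℕ}

/-- the files `W_n`, as sequences of packets in their original order -/
def files (ω : Outcome K N F S b) : Fin N → Fin F → Bits b := ω.1

/-- the permutations `φ_n` -/
def perms (ω : Outcome K N F S b) : Fin N → Equiv.Perm (Fin F) := ω.2.1

/-- the secret keys -/
def keys (ω : Outcome K N F S b) : Fin S → Bits b := ω.2.2.1

/-- the demand vector `d` -/
def demand (ω : Outcome K N F S b) : Fin K ↪ Fin N := ω.2.2.2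

end Outcome

namespace Scheme

variable {K N F S : ℕ} (C : Scheme K N F S) (b : ℕ)

/-- The coded signals addressed to groups that contain user `k`. -/
abbrev Slots (k : Fin K) : Type := {s : Fin S // k ∈ C.group s}

/-- The cached content `𝒵_k`: the set of the stored packets, each with its file number, its label
`φ_n(j)` and its bits (but without its original position `j`). -/
def cache (k : Fin K) (ω : Outcome K N F S b) : Finset (Fin N × Fin F × Bits b) :=
  (C.place k).image fun p => (p.1, ω.perms p.1 p.2, ω.files p.1 p.2)

/-- The bits of the packets in the cache of user `k`, without their labels. -/
def cacheBits (k : Fin K) (ω : Outcome K N F S b) : {p // p ∈ C.place k} → Bits b :=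
  fun p => ω.files p.1.1 p.1.2

/-- The secret keys `𝒯_k` cached by user `k`. -/
def userKeys (k : Fin K) (ω : Outcome K N F S b) : C.Slots k → Bits b :=
  fun s => ω.keys s.1

/-- The coded signal `X_𝒰` of the group `𝒰 = C.group s`. -/
def signal (s : Fin S) (ω : Outcome K N F S b) : Bits b :=
  ∑ p ∈ C.deliver ω.demand s, ω.files p.1 p.2

/-- The header of a coded signal: file numbers and labels of the packets in it. -/
def header (s : Fin S) (ω : Outcome K N F S b) : Finset (Fin N × Fin F) :=
  (C.deliver ω.demand s).image fun p => (p.1, ω.perms p.1 p.2)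

/-- What is broadcast for the group `C.group s`: the header and `T_𝒰 ⊕ X_𝒰`. -/
def broadcast (s : Fin S) (ω : Outcome K N F S b) : Finset (Fin N × Fin F) × Bits b :=
  (C.header b s ω, ω.keys s + C.signal b s ω)

/-- `C` is a secure `F`-division `(K, M, N)` coded caching scheme for files of `F * b` bits. -/
structure IsSecure (M : ℚ) : Prop where
  /-- `0 < M < N` -/
  M_pos : 0 < M
  M_lt : M < N
  /-- each user caches packets of total size `M` files -/
  memory : ∀ k, ((C.place k).card : ℚ) * b = M * (F * b)
  /-- each group of users gets at most one coded signal, hence has its own key -/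
  group_injective : Function.Injective C.group
  /-- each user caches `F (1 - M / N)` secret keys -/
  keys : ∀ k, (Fintype.card (C.Slots k) : ℚ) = F * (1 - M / N)
  /-- `H(W_{d_k} | 𝒵_k, 𝒯_k, {T_𝒰 ⊕ X_𝒰 : k ∈ 𝒰}, φ_{d_k}) = 0`: each user decodes its file -/
  decodable : ∀ k, condEntropy
    (fun ω : Outcome K N F S b => ω.files (ω.demand k))
    (fun ω => (C.cache b k ω, C.userKeys b k ω,
      (fun s : C.Slots k => C.broadcast b s.1 ω), ω.perms (ω.demand k))) = 0
  /-- `I(d_{-k} ; {X_𝒰 : k ∈ 𝒰} | φ_{d_k}, 𝒵_k, d_k) = 0`, where each signal comes with its header: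
  user `k` learns nothing about the demands of the others -/
  privacy : ∀ k, condMutualInfo
    (fun (ω : Outcome K N F S b) (l : {l : Fin K // l ≠ k}) => ω.demand l.1)
    (fun ω (s : C.Slots k) => (C.header b s.1 ω, C.signal b s.1 ω))
    (fun ω => (ω.perms (ω.demand k), C.cache b k ω, ω.demand k)) = 0
  /-- the bits that user `k` holds or decrypts, without the labels, carry no information about the
  permutations -/
  perms_secret : ∀ k, mutualInfo
    (fun ω : Outcome K N F S b => ω.perms)
    (fun ω => (C.cacheBits b k ω, C.userKeys b k ω,
      (fun s : C.Slots k => C.signal b s.1 ω))) = 0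
  /-- a wiretapper who observes the whole broadcast learns nothing about the files -/
  wiretap : mutualInfo
    (fun ω : Outcome K N F S b => ω.files)
    (fun ω (s : Fin S) => C.broadcast b s ω) = 0

/-- The transmission rate: each of the coded signals has the size of `1 / F` file. -/
def rate (_C : Scheme K N F S) : ℚ := ∑ _s : Fin S, 1 / (F : ℚ)

end Scheme

/-! ### Secure placement delivery arrays; the star is `none` -/

/-- The `(g + 1) × g` array whose row `0` is constantly `s`, and whose other rows form the array with
`s` on the diagonal and stars elsewhere. -/
def pattern {S : ℕ} (s : Fin S) (g : ℕ) (i : Fin (g + 1)) (l : Fin g) : Option (Fin S) :=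
  if i = 0 ∨ i = l.succ then some s else none

/-- `(K, F, Z, S)` secure placement delivery arrays. -/
structure IsSPDA (K F Z S : ℕ) (P : Fin F → Fin K → Option (Fin S)) : Prop where
  K_pos : 0 < K
  F_pos : 0 < F
  /-- the star appears `Z` times in each column -/
  stars : ∀ k, (Finset.univ.filter fun j => P j k = none).card = Z
  /-- each symbol appears at least four times -/
  four : ∀ s, 4 ≤ (Finset.univ.filter fun p : Fin F × Fin K => P p.1 p.2 = some s).card
  /-- the rows and columns that contain `s` form the above pattern, up to row and column
  permutations -/
  sub : ∀ s, ∃ (g : ℕ) (r : Fin (g + 1) ↪ Fin F) (c : Fin g ↪ Fin K),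
    (∀ j, j ∈ Set.range r ↔ ∃ k, P j k = some s) ∧
    (∀ k, k ∈ Set.range c ↔ ∃ j, P j k = some s) ∧
    ∀ i l, P (r i) (c l) = pattern s g i l

section Algorithm

variable {K F S : ℕ} (P : Fin F → Fin K → Option (Fin S))

/-- Row `j` contains the symbol `s` at least twice, i.e. `j = j^{(s)}`. -/
def IsMultiRow (s : Fin S) (j : Fin F) : Prop :=
  2 ≤ (Finset.univ.filter fun k => P j k = some s).card

/-- The set `𝒰_s` of the columns that contain `s`. -/
def columnsOf (s : Fin S) : Finset (Fin K) :=
  Finset.univ.filter fun k => ∃ j, P j k = some s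

open Classical in
/-- The coded caching scheme with `N` files that an array realizes. -/
noncomputable def schemeOf (N : ℕ) : Scheme K N F S where
  place k := Finset.univ.filter fun p =>
    P p.2 k = none ∨ ∃ s, P p.2 k = some s ∧ IsMultiRow P s p.2
  group s := columnsOf P s
  deliver d s :=
    ((Finset.univ.filter fun q : Fin F × Fin K =>
        P q.1 q.2 = some s ∧ ¬ IsMultiRow P s q.1).image fun q => (d q.2, q.1)) ∪
      Finset.univ.filter fun p : Fin N × Fin F =>
        IsMultiRow P s p.2 ∧ ∀ k ∈ columnsOf P s, d k ≠ p.1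

end Algorithm

/-! ### The construction from parallel classes -/

/-- `𝒟` partitions the `u`-subsets of `[0, v)` into `m` parallel classes, each of which partitions
`[0, v)`. -/
structure IsParallelClasses (v u m : ℕ) (𝒟 : Fin m → Finset (Finset ℕ)) : Prop where
  mem : ∀ i, ∀ D ∈ 𝒟 i, D ∈ Finset.powersetCard u (Finset.range v)
  disjoint : ∀ i, ∀ D ∈ 𝒟 i, ∀ E ∈ 𝒟 i, D ≠ E → Disjoint D E
  cover : ∀ i, ∀ x ∈ Finset.range v, ∃ D ∈ 𝒟 i, x ∈ D
  partition : ∀ D ∈ Finset.powersetCard u (Finset.range v), ∃! i, D ∈ 𝒟 i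

/-- The array `Q`, with rows the `t`-subsets of `[0, K)`: the entry is `A ∪ {k}` if `k ∉ A`, and a
star otherwise. -/
def arrayQ (A : Finset ℕ) (k : ℕ) : Option (Finset ℕ) :=
  if k ∈ A then none else some (A ∪ {k})

open Classical in
/-- The array `Q'`, with rows the parallel classes of `[0, K')`: the entry is the block through `k`
if this block does not meet `[K, K')`, and a star otherwise. -/
noncomputable def arrayQ' (K K' : ℕ) (𝒞 : Finset (Finset ℕ)) (k : ℕ) : Option (Finset ℕ) :=
  if h : ∃ D, D ∈ 𝒞 ∧ k ∈ D ∧ D ∩ Finset.Ico K K' = ∅ then some h.choose else none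

/-- `Q'` on top of `Q`. -/
noncomputable def stackedArray (K K' t : ℕ) {m : ℕ} (𝒟 : Fin m → Finset (Finset ℕ)) :
    Fin m ⊕ {A // A ∈ Finset.powersetCard t (Finset.range K)} → ℕ → Option (Finset ℕ)
  | .inl i, k => arrayQ' K K' (𝒟 i) k
  | .inr A, k => arrayQ A.1 k

/-- `P` arises from the stacked array by numbering its rows by `[0, F)` and the `(t+1)`-subsets of
`[0, K)` by `[0, S)`. -/
def IsNumberingOf {K F S : ℕ} (P : Fin F → Fin K → Option (Fin S)) (K' t : ℕ) {m : ℕ}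
    (𝒟 : Fin m → Finset (Finset ℕ)) : Prop :=
  ∃ (e : Fin F ≃ Fin m ⊕ {A // A ∈ Finset.powersetCard t (Finset.range K)})
    (f : Fin S ≃ {D // D ∈ Finset.powersetCard (t + 1) (Finset.range K)}),
    ∀ j k, (P j k).map (fun s => (f s).1) = stackedArray K K' t 𝒟 (e j) k

end SecureCaching

/-! Three facts are combined.

Parallel classes exist by Baranyai's theorem, proved by adding one point at a time. At stage `l`
there are partitions of `[0, l)` into `m` possibly empty parts, and each `S ⊆ [0, l)` occurs as a
part `(n - l).choose (k - |S|)` times in total (`IsBalanced`), as often as the final blocks must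
have trace `S`. The point `l` has to join one part of each partition, with every `S` chosen the
prescribed number of times. Weights `(k - |S|) / (n - l)` solve this fractionally, and Hall's
theorem makes the choice integral (`IsBalanced.exists_choice`).

For any SPDA, column `k` has two entries for each of its symbols `s`: one in the row `top s`, which
is stored, and one in `low s k`, which is not. Hence in a signal addressed to `k` only the packet of
the requested file is missing, which gives decoding. For each other file the signals of `k` use
pairwise different stored rows, whatever the other demands are; a permutation of the stored rows
turns one such choice of rows into another, so the secret `φ_n` hides the demands
(`IsRowSystem.privacy`). The keys are one-time pads. The information quantities vanish because
injective maps of the sample space change one variable and fix the others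
(`condMutualInfo_eq_zero_of_transport`).

In the stacked array a block `D` occurs in the row of its class, in all columns of `D`, and in each
row `D \ {x}` in column `x` only. This is the required pattern with `g = t + 1`
(`hasPattern_of_numbering`). The parameters follow from the two entries per symbol in each column.
-/

namespace SecureCaching

/-! ### Baranyai's theorem -/

section Baranyai

/-- The part with name `p` of the partition of `[0, l)` given by the colouring `g`. -/
def part {m : ℕ} (l : ℕ) (g : ℕ → Fin m) (p : Fin m) : Finset ℕ :=
  (Finset.range l).filter fun x => g x = p

/-- The number of `k`-subsets of an `n`-set whose trace on a fixed `l`-subset is a given set with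
`s` elements. -/
def traceCount (n k l s : ℕ) : ℕ := if s ≤ k then (n - l).choose (k - s) else 0

/-- The number of `k`-subsets as in `traceCount` that also contain a further given point. -/
def traceCountSucc (n k l s : ℕ) : ℕ := if s + 1 ≤ k then (n - l - 1).choose (k - s - 1) else 0

variable {n k l s m M : ℕ}

/-- Absorption identity: weight `(k - s) / (n - l)` on each of the `traceCount` occurrences of a set
amounts to `traceCountSucc`. -/
lemma traceCount_mul (hl : l < n) :
    traceCount n k l s * (k - s) = (n - l) * traceCountSucc n k l s := by
  unfold traceCount traceCountSucc
  rcases lt_trichotomy s k with h | h | h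
  · obtain ⟨a, ha⟩ : ∃ a, n - l = a + 1 := ⟨n - l - 1, by omega⟩
    obtain ⟨c, hc⟩ : ∃ c, k - s = c + 1 := ⟨k - s - 1, by omega⟩
    rw [if_pos h.le, if_pos (by omega), ha, hc]
    simp only [Nat.add_sub_cancel]
    exact (Nat.add_one_mul_choose_eq a c).symm
  · subst h; simp
  · rw [if_neg (by omega), if_neg (by omega)]; simp

/-- Pascal's rule: the occurrences of a trace split according to whether the point `l` joins them.
-/
lemma traceCount_succ_add (hl : l < n) :
    traceCount n k (l + 1) s + traceCountSucc n k l s = traceCount n k l s := by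
  unfold traceCount traceCountSucc
  obtain ⟨a, ha⟩ : ∃ a, n - l = a + 1 := ⟨n - l - 1, by omega⟩
  rcases lt_trichotomy s k with h | h | h
  · obtain ⟨c, hc⟩ : ∃ c, k - s = c + 1 := ⟨k - s - 1, by omega⟩
    rw [if_pos h.le, if_pos (by omega), if_pos h.le, ha, hc, show n - (l + 1) = a by omega]
    simp only [Nat.add_sub_cancel]
    rw [Nat.choose_succ_succ, add_comm]
  · subst h; simp
  · rw [if_neg (by omega), if_neg (by omega), if_neg (by omega)]

lemma traceCount_succ_succ : traceCount n k (l + 1) (s + 1) = traceCountSucc n k l s := by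
  unfold traceCount traceCountSucc
  rw [show n - (l + 1) = n - l - 1 by omega, show k - (s + 1) = k - s - 1 by omega]

lemma part_subset (g : ℕ → Fin m) (p : Fin m) : part l g p ⊆ Finset.range l :=
  Finset.filter_subset _ _

lemma sum_card_part (g : ℕ → Fin m) : ∑ p, (part l g p).card = l := by
  have := Finset.card_eq_sum_card_fiberwise (s := Finset.range l) (t := Finset.univ) (f := g)
    (fun _ _ => Finset.mem_coe.2 (Finset.mem_univ _))
  simpa [part] using this.symm

lemma part_update_eq (g : ℕ → Fin m) (q p : Fin m) :
    part (l + 1) (Function.update g l q) p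
      = if p = q then insert l (part l g p) else part l g p := by
  ext x
  simp only [part, Finset.mem_filter, Finset.mem_range]
  rcases eq_or_ne x l with rfl | hx
  · split_ifs with h <;> simp [Function.update_self, h, eq_comm (a := q)]
  · rw [Function.update_of_ne hx]
    split_ifs with h <;> simp [hx] <;> omega

/-- The colourings `g` cut every trace on `[0, l)` the right number of times. -/
def IsBalanced (n k l : ℕ) (g : Fin M → ℕ → Fin m) : Prop :=
  ∀ S, S ⊆ Finset.range l →
    (Finset.univ.filter fun q : Fin M × Fin m => part l (g q.1) q.2 = S).card
      = traceCount n k l S.card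

/-- The guard in `traceCount` forbids larger parts; truncated subtraction alone would allow each of
them once. -/
lemma IsBalanced.card_part_le {g : Fin M → ℕ → Fin m} (h : IsBalanced n k l g) (i : Fin M)
    (p : Fin m) : (part l (g i) p).card ≤ k := by
  by_contra hc
  have := h _ (part_subset (g i) p)
  rw [traceCount, if_neg hc, Finset.card_eq_zero, Finset.filter_eq_empty_iff] at this
  exact this (Finset.mem_univ (i, p)) rfl

/-- The deficits of the parts count the points still to be placed, so the weights `(k - |S|) / (n -
l)` add up to 1 in each partition. -/
lemma IsBalanced.sum_sub_card {g : Fin M → ℕ → Fin m} (h : IsBalanced n k l g) (hn : n = m * k)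
    (i : Fin M) : ∑ p, (k - (part l (g i) p).card) = n - l := by
  have h1 : ∑ p, ((k - (part l (g i) p).card) + (part l (g i) p).card) = m * k := by
    rw [Finset.sum_congr rfl fun p _ => Nat.sub_add_cancel (h.card_part_le i p)]
    simp
  rw [Finset.sum_add_distrib, sum_card_part] at h1
  omega

/-- Double counting the parts of some of the partitions. -/
lemma IsBalanced.card_mul_eq {g : Fin M → ℕ → Fin m} (h : IsBalanced n k l g) (hn : n = m * k)
    (I : Finset (Fin M)) (U : Finset (Finset ℕ)) (hU : ∀ i ∈ I, ∀ p, part l (g i) p ∈ U) :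
    I.card * (n - l) = ∑ S ∈ U,
      ((I ×ˢ Finset.univ).filter fun q => part l (g q.1) q.2 = S).card * (k - S.card) := by
  rw [← smul_eq_mul, ← Finset.sum_const, ← Finset.sum_congr rfl fun i _ => h.sum_sub_card hn i,
    ← Finset.sum_product' I Finset.univ fun i p => k - (part l (g i) p).card,
    ← Finset.sum_fiberwise_of_maps_to (t := U) (g := fun q : Fin M × Fin m => part l (g q.1) q.2)]
  · refine Finset.sum_congr rfl fun S _ => ?_
    rw [← smul_eq_mul, ← Finset.sum_const]
    refine Finset.sum_congr rfl fun q hq => ?_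
    rw [(Finset.mem_filter.1 hq).2]
  · intro q hq
    exact hU _ (Finset.mem_product.1 hq).1 _

/-- Hall's condition: the partitions in `I` carry total weight `I.card`, all on sets of `U`, and a
set carries at most `traceCountSucc` over all partitions. -/
lemma IsBalanced.card_le {g : Fin M → ℕ → Fin m} (h : IsBalanced n k l g) (hn : n = m * k)
    (hl : l < n) (I : Finset (Fin M)) (U : Finset (Finset ℕ))
    (hU : ∀ i ∈ I, ∀ p, part l (g i) p ∈ U) (hUl : ∀ S ∈ U, S ⊆ Finset.range l) :
    I.card ≤ ∑ S ∈ U, traceCountSucc n k l S.card := by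
  refine Nat.le_of_mul_le_mul_right (c := n - l) ?_ (by omega)
  rw [h.card_mul_eq hn I U hU, Finset.sum_mul]
  refine Finset.sum_le_sum fun S hS => ?_
  rw [mul_comm (traceCountSucc n k l S.card), ← traceCount_mul hl, ← h S (hUl S hS)]
  gcongr
  exact Finset.subset_univ _

lemma IsBalanced.card_eq {g : Fin M → ℕ → Fin m} (h : IsBalanced n k l g) (hn : n = m * k)
    (hl : l < n) :
    M = ∑ S ∈ (Finset.range l).powerset, traceCountSucc n k l S.card := by
  refine Nat.eq_of_mul_eq_mul_right (show 0 < n - l by omega) ?_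
  have := h.card_mul_eq hn Finset.univ (Finset.range l).powerset
    (fun i _ p => Finset.mem_powerset.2 (part_subset _ _))
  rw [Finset.card_univ, Fintype.card_fin] at this
  rw [this, Finset.sum_mul]
  refine Finset.sum_congr rfl fun S hS => ?_
  rw [mul_comm (traceCountSucc n k l S.card), ← traceCount_mul hl, ← h S (Finset.mem_powerset.1 hS)]
  rfl

/-- By Hall's theorem one part of each partition can be chosen such that every trace is chosen the
right number of times. -/
lemma IsBalanced.exists_choice {g : Fin M → ℕ → Fin m} (h : IsBalanced n k l g) (hn : n = m * k)
    (hl : l < n) : ∃ c : Fin M → Fin m, ∀ S, S ⊆ Finset.range l →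
      (Finset.univ.filter fun i => part l (g i) (c i) = S).card = traceCountSucc n k l S.card := by
  classical
  -- A token is a set with an index below its quota, so a system of distinct tokens never exceeds a
  -- quota. The quotas add up to `M`, so all of them are met exactly.
  let tok : Fin M → Finset (Σ _ : Finset ℕ, ℕ) := fun i =>
    (Finset.univ.image (part l (g i))).sigma fun S => Finset.range (traceCountSucc n k l S.card)
  obtain ⟨f, hf, hft⟩ := (Finset.all_card_le_biUnion_card_iff_exists_injective tok).1 (by
    intro I
    have hb : I.biUnion tok = (I.biUnion fun i => Finset.univ.image (part l (g i))).sigma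
        fun S => Finset.range (traceCountSucc n k l S.card) := by
      ext x
      simp only [tok, Finset.mem_biUnion, Finset.mem_sigma]
      constructor
      · rintro ⟨i, hi, h1, h2⟩
        exact ⟨⟨i, hi, h1⟩, h2⟩
      · rintro ⟨⟨i, hi, h1⟩, h2⟩
        exact ⟨i, hi, h1, h2⟩
    rw [hb, Finset.card_sigma]
    simp only [Finset.card_range]
    refine h.card_le hn hl I _ ?_ ?_
    · intro i hi p
      exact Finset.mem_biUnion.2 ⟨i, hi, Finset.mem_image_of_mem _ (Finset.mem_univ p)⟩
    · intro S hS
      obtain ⟨i, -, hi⟩ := Finset.mem_biUnion.1 hS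
      obtain ⟨p, -, rfl⟩ := Finset.mem_image.1 hi
      exact part_subset _ _)
  have hc : ∀ i, ∃ p, part l (g i) p = (f i).1 := by
    intro i
    obtain ⟨p, -, hp⟩ := Finset.mem_image.1 (Finset.mem_sigma.1 (hft i)).1
    exact ⟨p, hp⟩
  choose c hc using hc
  refine ⟨c, ?_⟩
  have hle : ∀ S ∈ (Finset.range l).powerset,
      (Finset.univ.filter fun i => part l (g i) (c i) = S).card
        ≤ traceCountSucc n k l S.card := by
    intro S _
    rw [← Finset.card_range (traceCountSucc n k l S.card)]
    refine Finset.card_le_card_of_injOn (fun i => (f i).2) ?_ ?_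
    · intro i hi
      have hi' := (Finset.mem_filter.1 (Finset.mem_coe.1 hi)).2
      have := (Finset.mem_sigma.1 (hft i)).2
      rwa [← hc i, hi'] at this
    · intro i hi i' hi' hii
      have h1 := (Finset.mem_filter.1 (Finset.mem_coe.1 hi)).2
      have h2 := (Finset.mem_filter.1 (Finset.mem_coe.1 hi')).2
      rw [hc] at h1 h2
      exact hf (Sigma.ext (h1.trans h2.symm) (heq_of_eq hii))
  have hsum : ∑ S ∈ (Finset.range l).powerset,
      (Finset.univ.filter fun i => part l (g i) (c i) = S).card
        = ∑ S ∈ (Finset.range l).powerset, traceCountSucc n k l S.card := by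
    rw [← h.card_eq hn hl, ← Finset.card_eq_sum_card_fiberwise]
    · simp
    · intro i _
      exact Finset.mem_coe.2 (Finset.mem_powerset.2 (part_subset _ _))
  intro S hS
  exact (Finset.sum_eq_sum_iff_of_le hle).1 hsum S (Finset.mem_powerset.2 hS)

/-- A set containing `l` arises from the chosen occurrences of its trace on `[0, l)`, a set without
`l` from its own unchosen occurrences. -/
lemma IsBalanced.succ {g : Fin M → ℕ → Fin m} (h : IsBalanced n k l g) (hn : n = m * k)
    (hl : l < n) : ∃ g' : Fin M → ℕ → Fin m, IsBalanced n k (l + 1) g' := by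
  obtain ⟨c, hc⟩ := h.exists_choice hn hl
  have hlp : ∀ i p, l ∉ part l (g i) p := fun i p hp => by simpa using part_subset _ _ hp
  have hgraph : ∀ S : Finset ℕ, (Finset.univ.filter fun q : Fin M × Fin m =>
      q.2 = c q.1 ∧ part l (g q.1) q.2 = S).card
        = (Finset.univ.filter fun i => part l (g i) (c i) = S).card := by
    intro S
    refine (Finset.card_bij' (fun i _ => (i, c i)) (fun q _ => q.1) ?_ ?_ ?_ ?_).symm
    · intro i hi; simpa using hi
    · rintro ⟨i, p⟩ hq
      simp only [Finset.mem_filter, Finset.mem_univ, true_and] at hq ⊢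
      rw [← hq.1]; exact hq.2
    · intro i _; rfl
    · rintro ⟨i, p⟩ hq
      simp only [Finset.mem_filter, Finset.mem_univ, true_and] at hq
      rw [hq.1]
  refine ⟨fun i => Function.update (g i) l (c i), fun T hT => ?_⟩
  simp only [part_update_eq]
  by_cases hlT : l ∈ T
  · have hcard : T.card = (T.erase l).card + 1 := (Finset.card_erase_add_one hlT).symm
    have hsub : T.erase l ⊆ Finset.range l := by
      intro x hx
      have := hT (Finset.mem_of_mem_erase hx)
      have := Finset.ne_of_mem_erase hx
      simp only [Finset.mem_range] at *
      omega
    rw [hcard, traceCount_succ_succ, ← hc _ hsub, ← hgraph]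
    congr 1
    refine Finset.filter_congr fun q _ => ?_
    split_ifs with hq
    · simp only [hq, true_and]
      constructor
      · intro h'
        rw [← h', Finset.erase_insert (hlp _ _)]
      · intro h'
        rw [h', Finset.insert_erase hlT]
    · simp only [hq, false_and, iff_false]
      rintro rfl
      exact hlp _ _ hlT
  · have hsub : T ⊆ Finset.range l := by
      intro x hx
      have := hT hx
      have : x ≠ l := fun h' => hlT (h' ▸ hx)
      simp only [Finset.mem_range] at *
      omega
    have h1 := h T hsub
    rw [← traceCount_succ_add hl, ← hc _ hsub, ← hgraph] at h1
    refine Nat.add_right_cancel (Eq.trans ?_ h1)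
    rw [← Finset.card_union_of_disjoint]
    · congr 1
      ext q
      simp only [Finset.mem_union, Finset.mem_filter, Finset.mem_univ, true_and]
      split_ifs with hq
      · have : insert l (part l (g q.1) q.2) ≠ T := by
          rintro rfl
          exact hlT (Finset.mem_insert_self _ _)
        exact ⟨fun h' => h'.elim (fun h' => absurd h' this) And.right, fun h' => Or.inr ⟨hq, h'⟩⟩
      · simp [hq]
    · rw [Finset.disjoint_left]
      intro q hq hq'
      simp only [Finset.mem_filter, Finset.mem_univ, true_and] at hq hq'
      rw [if_pos hq'.1] at hq
      exact hlT (hq ▸ Finset.mem_insert_self _ _)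

/-- **Baranyai's theorem**: if `k ∣ n`, then the `k`-subsets of an `n`-set can be partitioned into
parallel classes. -/
theorem exists_isParallelClasses (hk : 0 < k) (hn0 : 0 < n) (hkn : k ∣ n) :
    ∃ 𝒟 : Fin ((n - 1).choose (k - 1)) → Finset (Finset ℕ),
      IsParallelClasses n k ((n - 1).choose (k - 1)) 𝒟 := by
  obtain ⟨m, hm⟩ := hkn
  have hn : n = m * k := by rw [hm, mul_comm]
  have hm0 : 0 < m := Nat.pos_of_ne_zero (by rintro rfl; omega)
  have key : ∀ l, l ≤ n →
      ∃ g : Fin ((n - 1).choose (k - 1)) → ℕ → Fin m, IsBalanced n k l g := by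
    intro l
    induction l with
    | zero =>
      -- All parts of `[0, 0)` are empty, so the claim is that the number of pairs of a partition
      -- and a part is `n.choose k`.
      refine fun _ => ⟨fun _ _ => ⟨0, hm0⟩, fun S hS => ?_⟩
      have hS' : S = ∅ := by simpa using hS
      subst hS'
      have hmul : (n - 1).choose (k - 1) * m = n.choose k := by
        refine Nat.eq_of_mul_eq_mul_right hk ?_
        obtain ⟨a, rfl⟩ : ∃ a, n = a + 1 := ⟨n - 1, by omega⟩
        obtain ⟨c, rfl⟩ : ∃ c, k = c + 1 := ⟨k - 1, by omega⟩
        rw [mul_assoc, ← hn]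
        simp only [Nat.add_sub_cancel]
        rw [mul_comm, Nat.add_one_mul_choose_eq]
      simp [part, traceCount, hmul]
    | succ l ih =>
      intro hl
      obtain ⟨g, hg⟩ := ih (by omega)
      exact hg.succ hn (by omega)
  -- At `l = n` the quota `0.choose (k - s)` is 1 for `s = k` and 0 for smaller `s`.
  obtain ⟨g, hg⟩ := key n le_rfl
  have hcard : ∀ i p, (part n (g i) p).card = k := by
    intro i p
    refine le_antisymm (hg.card_part_le i p) ?_
    by_contra hc
    have h := hg _ (part_subset (g i) p)
    obtain ⟨c, hc'⟩ : ∃ c, k - (part n (g i) p).card = c + 1 :=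
      ⟨k - (part n (g i) p).card - 1, by omega⟩
    rw [traceCount, if_pos (by omega), Nat.sub_self, hc', Nat.choose_zero_succ,
      Finset.card_eq_zero, Finset.filter_eq_empty_iff] at h
    exact h (Finset.mem_univ (i, p)) rfl
  refine ⟨fun i => Finset.univ.image (part n (g i)), ?_, ?_, ?_, ?_⟩
  · intro i D hD
    obtain ⟨p, -, rfl⟩ := Finset.mem_image.1 hD
    exact Finset.mem_powersetCard.2 ⟨part_subset _ _, hcard i p⟩
  · intro i D hD E hE hDE
    obtain ⟨p, -, rfl⟩ := Finset.mem_image.1 hD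
    obtain ⟨q, -, rfl⟩ := Finset.mem_image.1 hE
    rw [Finset.disjoint_left]
    intro x hx hx'
    refine hDE ?_
    rw [← (Finset.mem_filter.1 hx).2, (Finset.mem_filter.1 hx').2]
  · intro i x hx
    exact ⟨part n (g i) (g i x), Finset.mem_image_of_mem _ (Finset.mem_univ _),
      Finset.mem_filter.2 ⟨hx, rfl⟩⟩
  · intro D hD
    obtain ⟨hD1, hD2⟩ := Finset.mem_powersetCard.1 hD
    have h := hg D hD1
    rw [hD2, traceCount, if_pos le_rfl, Nat.sub_self, Nat.sub_self, Nat.choose_self,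
      Finset.card_eq_one] at h
    obtain ⟨⟨i, p⟩, hip⟩ := h
    have hmem : ∀ q : Fin _ × Fin m, part n (g q.1) q.2 = D ↔ q = (i, p) := by
      intro q
      simpa using Finset.ext_iff.1 hip q
    refine ⟨i, Finset.mem_image.2 ⟨p, Finset.mem_univ _, (hmem (i, p)).2 rfl⟩, ?_⟩
    intro i' hi'
    obtain ⟨p', -, hp'⟩ := Finset.mem_image.1 hi'
    exact congrArg Prod.fst ((hmem (i', p')).1 hp')

end Baranyai

end SecureCaching

namespace SecureCaching

/-! ### Vanishing of Shannon quantities -/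

section Vanishing

variable {Ω α β γ : Type*} [Fintype Ω]

open Classical in
/-- The number of sample points at which `X` takes the value `a`. -/
noncomputable def hits (X : Ω → α) (a : α) : ℕ :=
  (Finset.univ.filter fun ω => X ω = a).card

lemma hits_pos (X : Ω → α) (ω : Ω) : 0 < hits X (X ω) := by
  classical
  exact Finset.card_pos.2 ⟨ω, Finset.mem_filter.2 ⟨Finset.mem_univ _, rfl⟩⟩

lemma prob_eq (X : Ω → α) (a : α) : prob X a = (hits X a : ℝ) / Fintype.card Ω := rfl

lemma card_pos_of_point (ω : Ω) : (0 : ℝ) < Fintype.card Ω := by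
  exact_mod_cast Fintype.card_pos_iff.2 ⟨ω⟩

lemma log_prob (X : Ω → α) (ω : Ω) :
    Real.log (prob X (X ω)) = Real.log (hits X (X ω)) - Real.log (Fintype.card Ω) := by
  rw [prob_eq, Real.log_div]
  · exact_mod_cast (hits_pos X ω).ne'
  · exact (card_pos_of_point ω).ne'

/-- Averaging over sample points instead of values gives all entropies the same index set, so
identities between them can be checked pointwise on `hits`. -/
lemma entropy_eq_sum (X : Ω → α) :
    entropy X = ∑ ω : Ω, (Real.log (Fintype.card Ω) - Real.log (hits X (X ω))) / Fintype.card Ω := by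
  classical
  unfold entropy
  rw [← Finset.sum_fiberwise_of_maps_to (t := Finset.univ.image X) (g := X)
    (fun ω _ => Finset.mem_image_of_mem X (Finset.mem_univ ω))]
  refine Finset.sum_congr (by congr) fun a ha => ?_
  obtain ⟨ω₀, -, rfl⟩ := Finset.mem_image.1 ha
  rw [Finset.sum_congr rfl (g := fun _ => (Real.log (Fintype.card Ω)
      - Real.log (hits X (X ω₀))) / Fintype.card Ω)
    (fun ω hω => by rw [(Finset.mem_filter.1 hω).2]), Finset.sum_const, nsmul_eq_mul,
    Real.negMulLog, log_prob, prob_eq]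
  have : (Finset.univ.filter fun ω => X ω = X ω₀).card = hits X (X ω₀) := by
    unfold hits; congr
  rw [this]
  ring

/-- A variable that is a function of the condition has conditional entropy zero. -/
lemma condEntropy_eq_zero (X : Ω → α) (Y : Ω → β) (h : ∀ ω ω', Y ω = Y ω' → X ω = X ω') :
    condEntropy X Y = 0 := by
  classical
  unfold condEntropy
  rw [entropy_eq_sum, entropy_eq_sum, sub_eq_zero]
  refine Finset.sum_congr rfl fun ω _ => ?_
  have : hits (fun ω => (X ω, Y ω)) (X ω, Y ω) = hits Y (Y ω) := by
    unfold hits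
    congr 1
    ext ω'
    simp only [Finset.mem_filter, Finset.mem_univ, true_and, Prod.mk.injEq]
    exact ⟨fun h' => h'.2, fun h' => ⟨h _ _ h', h'⟩⟩
  rw [this]

/-- The hypothesis is conditional independence, `p(x,y,z) p(z) = p(x,z) p(y,z)`, at the values that
occur; its logarithm annihilates each summand. -/
lemma condMutualInfo_eq_zero_of_hits (X : Ω → α) (Y : Ω → β) (Z : Ω → γ)
    (h : ∀ ω, hits (fun ω => (X ω, Y ω, Z ω)) (X ω, Y ω, Z ω) * hits Z (Z ω)
      = hits (fun ω => (X ω, Z ω)) (X ω, Z ω) * hits (fun ω => (Y ω, Z ω)) (Y ω, Z ω)) :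
    condMutualInfo X Y Z = 0 := by
  unfold condMutualInfo
  simp only [entropy_eq_sum]
  rw [← Finset.sum_add_distrib, ← Finset.sum_sub_distrib, ← Finset.sum_sub_distrib]
  refine Finset.sum_eq_zero fun ω _ => ?_
  have h1 := congrArg (fun x : ℕ => Real.log x) (h ω)
  simp only [Nat.cast_mul] at h1
  have p1 := (hits_pos (fun ω => (X ω, Y ω, Z ω)) ω).ne'
  have p2 := (hits_pos Z ω).ne'
  have p3 := (hits_pos (fun ω => (X ω, Z ω)) ω).ne'
  have p4 := (hits_pos (fun ω => (Y ω, Z ω)) ω).ne'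
  rw [Real.log_mul (by exact_mod_cast p1) (by exact_mod_cast p2),
    Real.log_mul (by exact_mod_cast p3) (by exact_mod_cast p4)] at h1
  rw [← add_div, ← sub_div, ← sub_div]
  refine div_eq_zero_iff.2 (Or.inl ?_)
  linarith

lemma hits_le_of_injOn (X : Ω → α) (a a' : α) (T : Ω → Ω)
    (hT : ∀ ω, X ω = a → X (T ω) = a') (hinj : Set.InjOn T {ω | X ω = a}) :
    hits X a ≤ hits X a' := by
  classical
  refine Finset.card_le_card_of_injOn T ?_ ?_
  · intro ω hω
    simpa using hT ω (by simpa using hω)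
  · intro ω hω ω' hω' h
    exact hinj (by simpa using hω) (by simpa using hω') h

lemma hits_eq_sum (X : Ω → α) (Y : Ω → β) (s : Finset α) (b : β)
    (hs : ∀ ω, Y ω = b → X ω ∈ s) :
    hits Y b = ∑ a ∈ s, hits (fun ω => (X ω, Y ω)) (a, b) := by
  classical
  unfold hits
  rw [Finset.card_eq_sum_card_fiberwise (f := X) (t := s)]
  · refine Finset.sum_congr rfl fun a _ => ?_
    rw [Finset.filter_filter]
    congr 1
    ext ω
    simp only [Finset.mem_filter, Finset.mem_univ, true_and, Prod.mk.injEq, and_comm]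
  · intro ω hω
    exact hs ω (by simpa using hω)

/-- `I(X ; Y | Z) = 0` if the values of `X` that are compatible with the same value of `Z` can be
transported into each other without changing `Y` and `Z`. -/
lemma condMutualInfo_eq_zero_of_transport (X : Ω → α) (Y : Ω → β) (Z : Ω → γ)
    (h : ∀ ω₀ ω₁, Z ω₀ = Z ω₁ → ∃ T : Ω → Ω,
      Set.InjOn T {ω | X ω = X ω₀ ∧ Z ω = Z ω₀} ∧
      ∀ ω, X ω = X ω₀ → Z ω = Z ω₀ → X (T ω) = X ω₁ ∧ Y (T ω) = Y ω ∧ Z (T ω) = Z ω) :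
    condMutualInfo X Y Z = 0 := by
  classical
  refine condMutualInfo_eq_zero_of_hits X Y Z fun ω₀ => ?_
  have le3 : ∀ ω₁ ω₂ y, Z ω₁ = Z ω₂ →
      hits (fun ω => (X ω, Y ω, Z ω)) (X ω₁, y, Z ω₁)
        ≤ hits (fun ω => (X ω, Y ω, Z ω)) (X ω₂, y, Z ω₂) := by
    intro ω₁ ω₂ y hz
    obtain ⟨T, hinj, hT⟩ := h ω₁ ω₂ hz
    refine hits_le_of_injOn _ _ _ T ?_ ?_
    · intro ω hω
      simp only [Prod.mk.injEq] at hω ⊢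
      obtain ⟨h1, h2, h3⟩ := hT ω hω.1 hω.2.2
      exact ⟨h1, h2.trans hω.2.1, h3.trans (hω.2.2.trans hz)⟩
    · refine hinj.mono fun ω hω => ?_
      simp only [Set.mem_ofPred_eq, Prod.mk.injEq] at hω ⊢
      exact ⟨hω.1, hω.2.2⟩
  have le2 : ∀ ω₁ ω₂, Z ω₁ = Z ω₂ →
      hits (fun ω => (X ω, Z ω)) (X ω₁, Z ω₁) ≤ hits (fun ω => (X ω, Z ω)) (X ω₂, Z ω₂) := by
    intro ω₁ ω₂ hz
    obtain ⟨T, hinj, hT⟩ := h ω₁ ω₂ hz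
    refine hits_le_of_injOn _ _ _ T ?_ ?_
    · intro ω hω
      simp only [Prod.mk.injEq] at hω ⊢
      obtain ⟨h1, h2, h3⟩ := hT ω hω.1 hω.2
      exact ⟨h1, h3.trans (hω.2.trans hz)⟩
    · refine hinj.mono fun ω hω => ?_
      simpa only [Set.mem_ofPred_eq, Prod.mk.injEq] using hω
  -- The values of `X` compatible with `Z ω₀` are equally frequent, both given `Z` and jointly with
  -- `Y`, so both fibres split into `G.card` equal pieces.
  let G := (Finset.univ.filter fun ω => Z ω = Z ω₀).image X
  have hG : ∀ ω, Z ω = Z ω₀ → X ω ∈ G := fun ω hω =>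
    Finset.mem_image_of_mem _ (Finset.mem_filter.2 ⟨Finset.mem_univ _, hω⟩)
  have e1 : hits Z (Z ω₀) = G.card * hits (fun ω => (X ω, Z ω)) (X ω₀, Z ω₀) := by
    rw [hits_eq_sum X Z G (Z ω₀) hG, ← smul_eq_mul, ← Finset.sum_const]
    refine Finset.sum_congr rfl fun x hx => ?_
    obtain ⟨ω₁, hω₁, rfl⟩ := Finset.mem_image.1 hx
    have hz := (Finset.mem_filter.1 hω₁).2
    have := le_antisymm (le2 _ _ hz) (le2 _ _ hz.symm)
    rwa [hz] at this
  have e2 : hits (fun ω => (Y ω, Z ω)) (Y ω₀, Z ω₀)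
      = G.card * hits (fun ω => (X ω, Y ω, Z ω)) (X ω₀, Y ω₀, Z ω₀) := by
    rw [hits_eq_sum X (fun ω => (Y ω, Z ω)) G (Y ω₀, Z ω₀) (fun ω hω => hG ω (congrArg Prod.snd hω)),
      ← smul_eq_mul, ← Finset.sum_const]
    refine Finset.sum_congr rfl fun x hx => ?_
    obtain ⟨ω₁, hω₁, rfl⟩ := Finset.mem_image.1 hx
    have hz := (Finset.mem_filter.1 hω₁).2
    have := le_antisymm (le3 _ _ (Y ω₀) hz) (le3 _ _ (Y ω₀) hz.symm)
    rwa [hz] at this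
  rw [e1, e2]
  ring

lemma entropy_const (c : α) : entropy (fun _ : Ω => c) = 0 := by
  rw [entropy_eq_sum]
  simp [hits]

lemma entropy_congr_of_injective (X : Ω → α) (f : α → β) (hf : Function.Injective f) :
    entropy (fun ω => f (X ω)) = entropy X := by
  have h : ∀ ω, hits (fun ω => f (X ω)) (f (X ω)) = hits X (X ω) := by
    intro ω
    unfold hits
    congr 1
    ext ω'
    simp only [Finset.mem_filter, Finset.mem_univ, true_and, hf.eq_iff]
  simp only [entropy_eq_sum, h]

/-- `I(X ; Y) = 0` if the values of `X` can be transported into each other without changing `Y`. -/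
lemma mutualInfo_eq_zero_of_transport (X : Ω → α) (Y : Ω → β)
    (h : ∀ ω₀ ω₁, ∃ T : Ω → Ω, Set.InjOn T {ω | X ω = X ω₀} ∧
      ∀ ω, X ω = X ω₀ → X (T ω) = X ω₁ ∧ Y (T ω) = Y ω) :
    mutualInfo X Y = 0 := by
  have key := condMutualInfo_eq_zero_of_transport X Y (fun _ => ()) (by
    intro ω₀ ω₁ _
    obtain ⟨T, hinj, hT⟩ := h ω₀ ω₁
    exact ⟨T, hinj.mono fun ω hω => hω.1, fun ω hω _ => ⟨(hT ω hω).1, (hT ω hω).2, rfl⟩⟩)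
  unfold condMutualInfo at key
  rw [entropy_const, sub_zero,
    entropy_congr_of_injective X (fun x => (x, ())) (fun _ _ h => congrArg Prod.fst h),
    entropy_congr_of_injective Y (fun x => (x, ())) (fun _ _ h => congrArg Prod.fst h),
    entropy_congr_of_injective (fun ω => (X ω, Y ω)) (fun p => (p.1, p.2, ()))
      (fun p q h => by simp only [Prod.mk.injEq] at h; exact Prod.ext h.1 h.2.1)] at key
  exact key

end Vanishing

end SecureCaching

namespace SecureCaching

/-! ### The scheme of a secure placement delivery array -/

section SchemeOfArray

variable {K F Z S : ℕ} {P : Fin F → Fin K → Option (Fin S)}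

/-- `top s` is the row that contains `s` in all the columns of `columnsOf P s`, and `low s k` is the
other row in which the column `k` contains `s`. -/
structure IsRowSystem (P : Fin F → Fin K → Option (Fin S)) (top : Fin S → Fin F)
    (low : Fin S → Fin K → Fin F) : Prop where
  multi_iff : ∀ s j, IsMultiRow P s j ↔ j = top s
  eq_some_iff : ∀ s j k, P j k = some s ↔ k ∈ columnsOf P s ∧ (j = top s ∨ j = low s k)
  low_ne_top : ∀ s k, k ∈ columnsOf P s → low s k ≠ top s
  low_eq_none : ∀ s k l, k ∈ columnsOf P s → l ∈ columnsOf P s → l ≠ k → P (low s l) k = none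

lemma mem_columnsOf {s : Fin S} {k : Fin K} : k ∈ columnsOf P s ↔ ∃ j, P j k = some s := by
  simp [columnsOf]

/-- The shape of the subarrays of an array as in `IsSPDA.sub`. -/
def HasPattern (P : Fin F → Fin K → Option (Fin S)) (s : Fin S) (g : ℕ) (r : Fin (g + 1) ↪ Fin F)
    (c : Fin g ↪ Fin K) : Prop :=
  (∀ j, j ∈ Set.range r ↔ ∃ k, P j k = some s) ∧
  (∀ k, k ∈ Set.range c ↔ ∃ j, P j k = some s) ∧
  ∀ i l, P (r i) (c l) = pattern s g i l

/-- Row 0 of the pattern is `top s`, row `l + 1` is `low s (c l)`. The pattern has `2g` entries `s`,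
so four occurrences force `g ≥ 2`; for `g = 1` no row would contain `s` twice. -/
lemma exists_rowSystem
    (hfour : ∀ s, 4 ≤ (Finset.univ.filter fun p : Fin F × Fin K => P p.1 p.2 = some s).card)
    (hsub : ∀ s, ∃ g r c, HasPattern P s g r c) :
    ∃ top low, IsRowSystem P top low := by
  have key : ∀ s, ∃ (top : Fin F) (low : Fin K → Fin F),
      (∀ j, IsMultiRow P s j ↔ j = top) ∧
      (∀ j k, P j k = some s ↔ k ∈ columnsOf P s ∧ (j = top ∨ j = low k)) ∧
      (∀ k, k ∈ columnsOf P s → low k ≠ top) ∧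
      (∀ k l, k ∈ columnsOf P s → l ∈ columnsOf P s → l ≠ k → P (low l) k = none) := by
    intro s
    obtain ⟨g, r, c, hr, hc, hpat⟩ := hsub s
    have hentry : ∀ j k, P j k = some s ↔
        ∃ i l, r i = j ∧ c l = k ∧ (i = 0 ∨ i = l.succ) := by
      intro j k
      constructor
      · intro hjk
        obtain ⟨i, rfl⟩ := (hr j).2 ⟨k, hjk⟩
        obtain ⟨l, rfl⟩ := (hc k).2 ⟨r i, hjk⟩
        refine ⟨i, l, rfl, rfl, ?_⟩
        rw [hpat, pattern] at hjk
        by_contra hcon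
        rw [if_neg hcon] at hjk
        cases hjk
      · rintro ⟨i, l, rfl, rfl, hil⟩
        rw [hpat, pattern, if_pos hil]
    have hcol : ∀ k, k ∈ columnsOf P s ↔ ∃ l, c l = k := fun k => mem_columnsOf.trans (hc k).symm
    have hg : 2 ≤ g := by
      have h4 := hfour s
      have hsub : (Finset.univ.filter fun p : Fin F × Fin K => P p.1 p.2 = some s)
          ⊆ (Finset.univ.image fun l => (r 0, c l)) ∪
            (Finset.univ.image fun l => (r l.succ, c l)) := by
        rintro ⟨j, k⟩ hp
        obtain ⟨i, l, rfl, rfl, rfl | rfl⟩ := (hentry j k).1 (Finset.mem_filter.1 hp).2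
        · exact Finset.mem_union_left _ (Finset.mem_image_of_mem _ (Finset.mem_univ l))
        · exact Finset.mem_union_right _
            (Finset.mem_image_of_mem (fun l => (r (Fin.succ l), c l)) (Finset.mem_univ l))
      have h1 := (Finset.card_le_card hsub).trans (Finset.card_union_le _ _)
      have h2 := Finset.card_image_le (s := Finset.univ) (f := fun l => (r 0, c l))
      have h3 := Finset.card_image_le (s := Finset.univ) (f := fun l => (r (Fin.succ l), c l))
      simp only [Finset.card_univ, Fintype.card_fin] at h2 h3
      omega
    have hmulti : ∀ j, IsMultiRow P s j ↔ j = r 0 := by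
      intro j
      constructor
      · intro hj
        obtain ⟨k, hk, k', hk', hne⟩ := Finset.one_lt_card.1 (show 1 < _ from hj)
        obtain ⟨i, l, rfl, rfl, hil⟩ := (hentry j k).1 (Finset.mem_filter.1 hk).2
        obtain ⟨i', l', hi', rfl, hil'⟩ := (hentry _ k').1 (Finset.mem_filter.1 hk').2
        obtain rfl := r.injective hi'
        rcases hil with rfl | rfl
        · rfl
        · rcases hil' with h0 | h0
          · rw [h0]
          · exact absurd (congrArg c (Fin.succ_injective _ h0)) hne
      · rintro rfl
        have : 1 < (Finset.univ.filter fun k => P (r 0) k = some s).card := by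
          refine Finset.one_lt_card.2 ⟨c ⟨0, by omega⟩, ?_, c ⟨1, by omega⟩, ?_, ?_⟩
          · exact Finset.mem_filter.2 ⟨Finset.mem_univ _,
              (hentry _ _).2 ⟨0, _, rfl, rfl, Or.inl rfl⟩⟩
          · exact Finset.mem_filter.2 ⟨Finset.mem_univ _,
              (hentry _ _).2 ⟨0, _, rfl, rfl, Or.inl rfl⟩⟩
          · intro h0
            simpa using c.injective h0
        exact this
    -- Outside the columns of `s` the value `r 0` is a dummy.
    have hlow : ∀ k, ∃ j, ∀ l, c l = k → j = r l.succ := by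
      intro k
      by_cases hk : ∃ l, c l = k
      · obtain ⟨l, rfl⟩ := hk
        exact ⟨r l.succ, fun l' hl' => by rw [c.injective hl']⟩
      · exact ⟨r 0, fun l hl => absurd ⟨l, hl⟩ hk⟩
    choose low hlow using hlow
    refine ⟨r 0, low, hmulti, ?_, ?_, ?_⟩
    · intro j k
      rw [hentry, hcol]
      constructor
      · rintro ⟨i, l, rfl, rfl, rfl | rfl⟩
        · exact ⟨⟨l, rfl⟩, Or.inl rfl⟩
        · exact ⟨⟨l, rfl⟩, Or.inr (hlow _ l rfl).symm⟩
      · rintro ⟨⟨l, rfl⟩, rfl | rfl⟩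
        · exact ⟨0, l, rfl, rfl, Or.inl rfl⟩
        · exact ⟨l.succ, l, (hlow _ l rfl).symm, rfl, Or.inr rfl⟩
    · intro k hk h0
      obtain ⟨l, rfl⟩ := (hcol k).1 hk
      rw [hlow _ l rfl] at h0
      exact Fin.succ_ne_zero l (r.injective h0)
    · intro k l hk hl hlk
      obtain ⟨a, rfl⟩ := (hcol k).1 hk
      obtain ⟨a', rfl⟩ := (hcol l).1 hl
      rw [hlow _ a' rfl, hpat, pattern, if_neg]
      rintro (h0 | h0)
      · exact Fin.succ_ne_zero _ h0
      · exact hlk (congrArg c (Fin.succ_injective _ h0))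
  choose top low h1 h2 h3 h4 using key
  exact ⟨top, low, h1, h2, h3, h4⟩

/-- Row `j` is stored by user `k`. -/
def IsCachedRow (P : Fin F → Fin K → Option (Fin S)) (k : Fin K) (j : Fin F) : Prop :=
  P j k = none ∨ ∃ s, P j k = some s ∧ IsMultiRow P s j

lemma mem_place {N : ℕ} {k : Fin K} {p : Fin N × Fin F} :
    p ∈ (schemeOf P N).place k ↔ IsCachedRow P k p.2 := by
  simp [schemeOf, IsCachedRow]

open Classical in
/-- The row of the packet of the file `n` that contributes to the signal `s`. -/
noncomputable def rowOf {N : ℕ} (P : Fin F → Fin K → Option (Fin S)) (top : Fin S → Fin F)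
    (low : Fin S → Fin K → Fin F) (d : Fin K ↪ Fin N) (s : Fin S) (n : Fin N) : Fin F :=
  if h : ∃ l, l ∈ columnsOf P s ∧ d l = n then low s h.choose else top s

namespace IsRowSystem

variable {N : ℕ} {top : Fin S → Fin F} {low : Fin S → Fin K → Fin F}
  (hR : IsRowSystem P top low)

lemma rowOf_demand (d : Fin K ↪ Fin N) {s : Fin S} {l : Fin K} (hl : l ∈ columnsOf P s) :
    rowOf P top low d s (d l) = low s l := by
  have h : ∃ l', l' ∈ columnsOf P s ∧ d l' = d l := ⟨l, hl, rfl⟩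
  rw [rowOf, dif_pos h, d.injective h.choose_spec.2]

lemma rowOf_of_forall_ne (d : Fin K ↪ Fin N) {s : Fin S} {n : Fin N}
    (hn : ∀ l ∈ columnsOf P s, d l ≠ n) : rowOf P top low d s n = top s := by
  rw [rowOf, dif_neg]
  rintro ⟨l, hl, h⟩
  exact hn l hl h

lemma rowOf_cases (d : Fin K ↪ Fin N) (s : Fin S) (n : Fin N) :
    (∃ l ∈ columnsOf P s, d l = n ∧ rowOf P top low d s n = low s l) ∨
      ((∀ l ∈ columnsOf P s, d l ≠ n) ∧ rowOf P top low d s n = top s) := by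
  by_cases h : ∀ l ∈ columnsOf P s, d l ≠ n
  · exact Or.inr ⟨h, rowOf_of_forall_ne d h⟩
  · push Not at h
    obtain ⟨l, hl, rfl⟩ := h
    exact Or.inl ⟨l, hl, rfl, rowOf_demand d hl⟩

include hR

lemma top_eq {s : Fin S} {k : Fin K} (hk : k ∈ columnsOf P s) : P (top s) k = some s :=
  (hR.eq_some_iff _ _ _).2 ⟨hk, Or.inl rfl⟩

lemma low_eq {s : Fin S} {k : Fin K} (hk : k ∈ columnsOf P s) : P (low s k) k = some s :=
  (hR.eq_some_iff _ _ _).2 ⟨hk, Or.inr rfl⟩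

/-- A non-star entry of column `k` lies either in the top row of its symbol, which is stored, or in
the low row, which is not. -/
lemma isCachedRow_iff {k : Fin K} {j : Fin F} :
    IsCachedRow P k j ↔ ¬ ∃ s, k ∈ columnsOf P s ∧ low s k = j := by
  constructor
  · rintro h ⟨s, hs, rfl⟩
    rcases h with h | ⟨s', h, h'⟩
    · rw [hR.low_eq hs] at h; cases h
    · rw [hR.low_eq hs] at h
      cases h
      exact hR.low_ne_top _ _ hs ((hR.multi_iff _ _).1 h')
  · intro h
    rcases hP : P j k with _ | s
    · exact Or.inl hP
    · refine Or.inr ⟨s, hP, (hR.multi_iff _ _).2 ?_⟩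
      obtain ⟨hs, h' | h'⟩ := (hR.eq_some_iff _ _ _).1 hP
      · exact h'
      · exact absurd ⟨s, hs, h'.symm⟩ h

/-- Every signal contains exactly one packet of each of the `N` files; the demands only affect which
row it comes from. -/
lemma deliver_eq (d : Fin K ↪ Fin N) (s : Fin S) :
    (schemeOf P N).deliver d s = Finset.univ.image fun n => (n, rowOf P top low d s n) := by
  classical
  ext ⟨n, j⟩
  simp only [schemeOf, Finset.mem_union, Finset.mem_image, Finset.mem_filter, Finset.mem_univ,
    true_and, Prod.mk.injEq, exists_eq_left, hR.multi_iff, Prod.exists]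
  constructor
  · rintro (⟨j', k, ⟨h1, h2⟩, rfl, rfl⟩ | ⟨rfl, h⟩)
    · obtain ⟨hk, h' | h'⟩ := (hR.eq_some_iff _ _ _).1 h1
      · exact absurd h' h2
      · rw [rowOf_demand d hk, h']
    · exact rowOf_of_forall_ne d h
  · rintro rfl
    rcases rowOf_cases (top := top) (low := low) d s n with ⟨l, hl, rfl, h⟩ | ⟨h, h'⟩
    · rw [h]
      exact Or.inl ⟨_, l, ⟨hR.low_eq hl, hR.low_ne_top s l hl⟩, rfl, rfl⟩
    · exact Or.inr ⟨h', h⟩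

lemma signal_eq (b : ℕ) (s : Fin S) (ω : Outcome K N F S b) :
    (schemeOf P N).signal b s ω = ∑ n, ω.files n (rowOf P top low ω.demand s n) := by
  rw [Scheme.signal, hR.deliver_eq, Finset.sum_image]
  intro n _ n' _ h
  exact congrArg Prod.fst h

lemma header_eq (b : ℕ) (s : Fin S) (ω : Outcome K N F S b) :
    (schemeOf P N).header b s ω
      = Finset.univ.image fun n => (n, ω.perms n (rowOf P top low ω.demand s n)) := by
  rw [Scheme.header, hR.deliver_eq, Finset.image_image]
  rfl

/-- The row is `low s l` with `l ≠ k`, where column `k` has a star, or it is `top s`. So user `k`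
can cancel the packets of all files but its own. -/
lemma isCachedRow_rowOf (d : Fin K ↪ Fin N) {s : Fin S} {k : Fin K} {n : Fin N}
    (hk : k ∈ columnsOf P s) (hn : n ≠ d k) : IsCachedRow P k (rowOf P top low d s n) := by
  rcases rowOf_cases (top := top) (low := low) d s n with ⟨l, hl, rfl, h⟩ | ⟨_, h⟩
  · rw [h]
    exact Or.inl (hR.low_eq_none s k l hk hl fun h' => hn (congrArg d h'))
  · rw [h]
    exact Or.inr ⟨s, hR.top_eq hk, (hR.multi_iff _ _).2 rfl⟩

/-- The row reveals the symbol: `top s` has `s` in column `k`, while `low s l` has a star there and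
`s` in column `l`, the only user demanding `n`. -/
lemma rowOf_injective (d : Fin K ↪ Fin N) {k : Fin K} {n : Fin N} (hn : n ≠ d k) {s s' : Fin S}
    (hs : k ∈ columnsOf P s) (hs' : k ∈ columnsOf P s')
    (h : rowOf P top low d s n = rowOf P top low d s' n) : s = s' := by
  have ne : ∀ l, d l = n → l ≠ k := fun l hl hlk => hn (hlk ▸ hl.symm)
  rcases rowOf_cases (top := top) (low := low) d s n with ⟨l, hl, hln, e⟩ | ⟨_, e⟩ <;>
  rcases rowOf_cases (top := top) (low := low) d s' n with ⟨l', hl', hln', e'⟩ | ⟨_, e'⟩ <;>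
  rw [e, e'] at h
  · obtain rfl := d.injective (hln.trans hln'.symm)
    have h1 := hR.low_eq hl
    rw [h, hR.low_eq hl'] at h1
    exact (Option.some.inj h1).symm
  · have h1 := hR.low_eq_none s k l hs hl (ne l hln)
    rw [h, hR.top_eq hs'] at h1
    cases h1
  · have h1 := hR.low_eq_none s' k l' hs' hl' (ne l' hln')
    rw [← h, hR.top_eq hs] at h1
    cases h1
  · have h1 := hR.top_eq hs
    rw [h, hR.top_eq hs'] at h1
    exact (Option.some.inj h1).symm

end IsRowSystem

/-! ### Decoding -/

lemma mem_cache_iff {N b : ℕ} {k : Fin K} {ω : Outcome K N F S b} {n : Fin N} {j : Fin F}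
    {w : Bits b} : (n, ω.perms n j, w) ∈ (schemeOf P N).cache b k ω ↔
      IsCachedRow P k j ∧ ω.files n j = w := by
  simp only [Scheme.cache, Finset.mem_image, mem_place, Prod.exists, Prod.mk.injEq]
  constructor
  · rintro ⟨n', j', h, rfl, h', rfl⟩
    obtain rfl := (ω.perms n').injective h'
    exact ⟨h, rfl⟩
  · rintro ⟨h, rfl⟩
    exact ⟨n, j, h, rfl, rfl, rfl⟩

namespace IsRowSystem

variable {N : ℕ} {top : Fin S → Fin F} {low : Fin S → Fin K → Fin F}
  (hR : IsRowSystem P top low)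

include hR

/-- The user `k` reads its demand off any header that is addressed to it: the requested file is the
only one whose packet in the signal is not in the cache. -/
lemma demand_eq_of_header_eq {b : ℕ} {k : Fin K} {s : Fin S} (hs : k ∈ columnsOf P s)
    {ω ω' : Outcome K N F S b}
    (hcache : (schemeOf P N).cache b k ω = (schemeOf P N).cache b k ω')
    (hheader : (schemeOf P N).header b s ω = (schemeOf P N).header b s ω') :
    ω.demand k = ω'.demand k := by
  by_contra hne
  have h1 : (ω.demand k, ω.perms (ω.demand k) (low s k)) ∈ (schemeOf P N).header b s ω := by
    rw [hR.header_eq, Finset.mem_image]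
    exact ⟨_, Finset.mem_univ _, by rw [rowOf_demand _ hs]⟩
  rw [hheader, hR.header_eq, Finset.mem_image] at h1
  obtain ⟨n, -, hn⟩ := h1
  obtain ⟨rfl, hn⟩ := Prod.mk.inj hn
  have h2 := (mem_cache_iff (ω := ω') (n := ω.demand k)).2
    ⟨hR.isCachedRow_rowOf ω'.demand hs hne, rfl⟩
  rw [hn, ← hcache, mem_cache_iff] at h2
  exact hR.isCachedRow_iff.1 h2.1 ⟨s, hs, rfl⟩

/-- Two outcomes with equal observations are compared. At least one signal is needed since `d_k`
itself is not observed but read off a header. -/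
lemma decodable (b : ℕ) (k : Fin K) (hk : ∃ s, k ∈ columnsOf P s) :
    condEntropy (fun ω : Outcome K N F S b => ω.files (ω.demand k))
      (fun ω => ((schemeOf P N).cache b k ω, (schemeOf P N).userKeys b k ω,
        (fun s : (schemeOf P N).Slots k => (schemeOf P N).broadcast b s.1 ω),
        ω.perms (ω.demand k))) = 0 := by
  refine condEntropy_eq_zero _ _ fun ω ω' h => ?_
  obtain ⟨hcache, h⟩ := Prod.mk.inj h
  obtain ⟨hkeys, h⟩ := Prod.mk.inj h
  obtain ⟨hbroad, hperm⟩ := Prod.mk.inj h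
  have hheader : ∀ s, k ∈ columnsOf P s →
      (schemeOf P N).header b s ω = (schemeOf P N).header b s ω' := fun s hs =>
    congrArg Prod.fst (congrFun hbroad ⟨s, hs⟩)
  have hsignal : ∀ s, k ∈ columnsOf P s →
      (schemeOf P N).signal b s ω = (schemeOf P N).signal b s ω' := by
    intro s hs
    have h1 : ω.keys s + (schemeOf P N).signal b s ω
        = ω'.keys s + (schemeOf P N).signal b s ω' :=
      congrArg Prod.snd (congrFun hbroad ⟨s, hs⟩)
    have h2 : ω.keys s = ω'.keys s := congrFun hkeys ⟨s, hs⟩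
    rw [h2] at h1
    exact add_left_cancel h1
  obtain ⟨s₀, hs₀⟩ := hk
  have hd : ω.demand k = ω'.demand k := hR.demand_eq_of_header_eq hs₀ hcache (hheader s₀ hs₀)
  -- The cache is an unordered set, so its packets are matched by label; only for the requested file
  -- does `φ_{d_k}` convert labels to positions.
  have hlookup : ∀ n j j', IsCachedRow P k j → ω.perms n j = ω'.perms n j' →
      ω.files n j = ω'.files n j' := by
    intro n j j' hj hjj
    have h1 := (mem_cache_iff (ω := ω) (n := n)).2 ⟨hj, rfl⟩
    rw [hcache, hjj, mem_cache_iff] at h1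
    exact h1.2.symm
  rw [← hd] at hperm ⊢
  funext j
  by_cases hj : IsCachedRow P k j
  · exact hlookup _ _ _ hj (by rw [hperm])
  · rw [hR.isCachedRow_iff, not_not] at hj
    obtain ⟨s, hs, rfl⟩ := hj
    have hsig := hsignal s hs
    rw [hR.signal_eq, hR.signal_eq,
      ← Finset.add_sum_erase _ _ (Finset.mem_univ (ω.demand k)),
      ← Finset.add_sum_erase _ _ (Finset.mem_univ (ω.demand k)), rowOf_demand _ hs] at hsig
    rw [hd, rowOf_demand _ hs, ← hd] at hsig
    refine add_right_cancel (hsig.trans (congrArg _ ?_))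
    refine Finset.sum_congr rfl fun n hn => ?_
    have hne := Finset.ne_of_mem_erase hn
    refine (hlookup _ _ _ (hR.isCachedRow_rowOf _ hs hne) ?_).symm
    have h1 : (n, ω.perms n (rowOf P top low ω.demand s n)) ∈ (schemeOf P N).header b s ω := by
      rw [hR.header_eq]
      exact Finset.mem_image_of_mem _ (Finset.mem_univ n)
    rw [hheader s hs, hR.header_eq, Finset.mem_image] at h1
    obtain ⟨n', -, h1⟩ := h1
    obtain ⟨rfl, h1⟩ := Prod.mk.inj h1
    exact h1.symm

end IsRowSystem

/-! ### Demand privacy -/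

/-- Two injective families in a finite set are related by a permutation that preserves a subset
containing both of them. -/
lemma exists_perm_comp_eq {ι α : Type*} [Finite α] (p : α → Prop) (f g : ι → α)
    (hf : Function.Injective f) (hg : Function.Injective g) (hfp : ∀ i, p (f i))
    (hgp : ∀ i, p (g i)) :
    ∃ π : Equiv.Perm α, (∀ a, p (π a) ↔ p a) ∧ ∀ i, π (f i) = g i := by
  classical
  let f' : ι → {a // p a} := fun i => ⟨f i, hfp i⟩
  let g' : ι → {a // p a} := fun i => ⟨g i, hgp i⟩
  have hf' : Function.Injective f' := fun i i' h => hf (congrArg Subtype.val h)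
  have hg' : Function.Injective g' := fun i i' h => hg (congrArg Subtype.val h)
  let e : {x // x ∈ Set.range f'} ≃ {x // x ∈ Set.range g'} :=
    (Equiv.ofInjective f' hf').symm.trans (Equiv.ofInjective g' hg')
  refine ⟨Equiv.Perm.ofSubtype e.extendSubtype, fun a => ?_, fun i => ?_⟩
  · by_cases ha : p a
    · rw [Equiv.Perm.ofSubtype_apply_of_mem _ ha]
      exact iff_of_true (Subtype.prop _) ha
    · rw [Equiv.Perm.ofSubtype_apply_of_not_mem _ ha]
  · rw [Equiv.Perm.ofSubtype_apply_of_mem _ (hfp i)]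
    have h1 := e.extendSubtype_apply_of_mem (f' i) ⟨i, rfl⟩
    have h2 : (Equiv.ofInjective f' hf').symm ⟨f' i, ⟨i, rfl⟩⟩ = i :=
      Equiv.ofInjective_symm_apply hf' i
    have h3 : e ⟨f' i, ⟨i, rfl⟩⟩ = Equiv.ofInjective g' hg' i := by
      simp only [e, Equiv.trans_apply, h2]
    rw [h3] at h1
    exact congrArg Subtype.val h1

namespace IsRowSystem

variable {N : ℕ} {top : Fin S → Fin F} {low : Fin S → Fin K → Fin F}
  (hR : IsRowSystem P top low)

include hR

/-- The rows that two demand vectors use for a given file can be exchanged within the rows that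
user `k` stores. -/
lemma exists_row_perm {k : Fin K} {d d' : Fin K ↪ Fin N} (hd : d k = d' k) (n : Fin N) :
    ∃ π : Equiv.Perm (Fin F), (∀ j, IsCachedRow P k (π j) ↔ IsCachedRow P k j) ∧
      (∀ s, k ∈ columnsOf P s → π (rowOf P top low d' s n) = rowOf P top low d s n) ∧
      (n = d k → π = 1) := by
  by_cases hn : n = d k
  · refine ⟨1, fun j => Iff.rfl, fun s hs => ?_, fun _ => rfl⟩
    rw [Equiv.Perm.one_apply, hn, rowOf_demand d hs, hd, rowOf_demand d' hs]
  · have hn' : n ≠ d' k := hd ▸ hn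
    obtain ⟨π, h1, h2⟩ := exists_perm_comp_eq (ι := {s // k ∈ columnsOf P s}) (IsCachedRow P k)
      (fun s => rowOf P top low d' s.1 n) (fun s => rowOf P top low d s.1 n)
      (fun s s' h => Subtype.ext (hR.rowOf_injective d' hn' s.2 s'.2 h))
      (fun s s' h => Subtype.ext (hR.rowOf_injective d hn s.2 s'.2 h))
      (fun s => hR.isCachedRow_rowOf d' s.2 hn') (fun s => hR.isCachedRow_rowOf d s.2 hn)
    exact ⟨π, h1, fun s hs => h2 ⟨s, hs⟩, fun h => absurd h hn⟩

lemma privacy (b : ℕ) (k : Fin K) :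
    condMutualInfo
      (fun (ω : Outcome K N F S b) (l : {l : Fin K // l ≠ k}) => ω.demand l.1)
      (fun ω (s : (schemeOf P N).Slots k) =>
        ((schemeOf P N).header b s.1 ω, (schemeOf P N).signal b s.1 ω))
      (fun ω => (ω.perms (ω.demand k), (schemeOf P N).cache b k ω, ω.demand k)) = 0 := by
  refine condMutualInfo_eq_zero_of_transport _ _ _ fun ω₀ ω₁ hz => ?_
  have hd : ω₀.demand k = ω₁.demand k := congrArg (fun z => z.2.2) hz
  choose π hcached hrow hone using hR.exists_row_perm hd
  -- The packets are moved by `π n` and the labels move along, so labelled packets are unchanged as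
  -- a set. Stored rows stay stored, `φ_{d_k}` is fixed as `π (d k) = 1`, and the rows used for the
  -- new demands carry the packets and labels used for the old ones.
  let T : Outcome K N F S b → Outcome K N F S b := fun ω =>
    (fun n j => ω.files n (π n j), fun n => (π n).trans (ω.perms n), ω.keys, ω₁.demand)
  have hdemand : ∀ ω : Outcome K N F S b,
      (fun l : {l : Fin K // l ≠ k} => ω.demand l.1) = (fun l => ω₀.demand l.1) →
      (ω.perms (ω.demand k), (schemeOf P N).cache b k ω, ω.demand k)
        = (ω₀.perms (ω₀.demand k), (schemeOf P N).cache b k ω₀, ω₀.demand k) →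
      ω.demand = ω₀.demand := by
    intro ω hx hz
    ext l : 1
    by_cases hl : l = k
    · rw [hl]; exact congrArg (fun z => z.2.2) hz
    · exact congrFun hx ⟨l, hl⟩
  refine ⟨T, ?_, ?_⟩
  · rintro ω ⟨hx, hz⟩ ω' ⟨hx', hz'⟩ hT
    have hfiles : ω.files = ω'.files := by
      funext n j
      have := congrFun (congrFun (congrArg Outcome.files hT) n) ((π n).symm j)
      simpa [T, Outcome.files] using this
    have hperms : ω.perms = ω'.perms := by
      funext n
      ext j : 1
      have := congrArg (fun σ : Equiv.Perm (Fin F) => σ ((π n).symm j))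
        (congrFun (congrArg Outcome.perms hT) n)
      simpa [T, Outcome.perms] using this
    have hkeys : ω.keys = ω'.keys := (congrArg Outcome.keys hT :)
    have hdem : ω.demand = ω'.demand := (hdemand ω hx hz).trans (hdemand ω' hx' hz').symm
    exact Prod.ext hfiles (Prod.ext hperms (Prod.ext hkeys hdem))
  · intro ω hx hz
    have hω := hdemand ω hx hz
    refine ⟨rfl, ?_, ?_⟩
    · funext s
      refine Prod.ext ?_ ?_
      · simp only [hR.header_eq]
        refine congrArg (fun f => Finset.univ.image f) (funext fun n => ?_)
        change (n, ω.perms n (π n (rowOf P top low ω₁.demand s.1 n))) = _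
        rw [hrow n s.1 s.2, hω]
      · simp only [hR.signal_eq]
        refine Finset.sum_congr rfl fun n _ => ?_
        change ω.files n (π n (rowOf P top low ω₁.demand s.1 n)) = _
        rw [hrow n s.1 s.2, hω]
    · refine Prod.ext ?_ (Prod.ext ?_ ?_)
      · change (π (ω₁.demand k)).trans (ω.perms (ω₁.demand k)) = ω.perms (ω.demand k)
        rw [hone _ hd.symm, hω, hd]
        rfl
      · ext ⟨n, a, w⟩
        obtain ⟨j, rfl⟩ := ((π n).trans (ω.perms n)).surjective a
        change (n, (T ω).perms n j, w) ∈ (schemeOf P N).cache b k (T ω) ↔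
          (n, ω.perms n (π n j), w) ∈ (schemeOf P N).cache b k ω
        rw [mem_cache_iff, mem_cache_iff, hcached]
        rfl
      · change ω₁.demand k = ω.demand k
        rw [hω, hd]

end IsRowSystem

/-! ### Secrecy of the permutations and of the files -/

/-- The bits of the cached packets, the keys and the signals do not depend on the permutations. -/
lemma Scheme.perms_secret_of_independent {N : ℕ} (C : Scheme K N F S) (b : ℕ) (k : Fin K) :
    mutualInfo (fun ω : Outcome K N F S b => ω.perms)
      (fun ω => (C.cacheBits b k ω, C.userKeys b k ω,
        (fun s : C.Slots k => C.signal b s.1 ω))) = 0 := by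
  refine mutualInfo_eq_zero_of_transport _ _ fun ω₀ ω₁ =>
    ⟨fun ω => (ω.files, ω₁.perms, ω.keys, ω.demand), ?_, fun ω _ => ⟨rfl, rfl⟩⟩
  intro ω hω ω' hω' h
  exact Prod.ext (congrArg Outcome.files h :) (Prod.ext (Eq.trans hω (Eq.symm hω'))
    (Prod.ext (congrArg Outcome.keys h :) (congrArg Outcome.demand h :)))

/-- The keys are one-time pads: the broadcast is independent of the files. -/
lemma Scheme.wiretap_of_oneTimePad {N : ℕ} (C : Scheme K N F S) (b : ℕ) :
    mutualInfo (fun ω : Outcome K N F S b => ω.files)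
      (fun ω (s : Fin S) => C.broadcast b s ω) = 0 := by
  refine mutualInfo_eq_zero_of_transport _ _ fun ω₀ ω₁ => ?_
  let sig : (Fin N → Fin F → Bits b) → (Fin K ↪ Fin N) → Fin S → Bits b :=
    fun W d s => ∑ p ∈ C.deliver d s, W p.1 p.2
  -- The new keys absorb the change of the signals; headers do not involve the bits of the files.
  refine ⟨fun ω => (ω₁.files, ω.perms,
    fun s => ω.keys s + sig ω₀.files ω.demand s - sig ω₁.files ω.demand s, ω.demand), ?_, ?_⟩
  · intro ω hω ω' hω' h
    have hd : ω.demand = ω'.demand := (congrArg Outcome.demand h :)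
    refine Prod.ext (Eq.trans hω (Eq.symm hω')) (Prod.ext (congrArg Outcome.perms h :)
      (Prod.ext (funext fun s => ?_) hd))
    have hk := congrFun (congrArg Outcome.keys h) s
    change ω.keys s + sig ω₀.files ω.demand s - sig ω₁.files ω.demand s
      = ω'.keys s + sig ω₀.files ω'.demand s - sig ω₁.files ω'.demand s at hk
    rw [hd] at hk
    exact add_right_cancel (sub_left_injective hk)
  · intro ω hω
    refine ⟨rfl, funext fun s => Prod.ext rfl ?_⟩
    change ω.keys s + sig ω₀.files ω.demand s - sig ω₁.files ω.demand s
      + sig ω₁.files ω.demand s = ω.keys s + sig ω.files ω.demand s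
    rw [sub_add_cancel, hω]

/-! ### Memory and number of keys -/

open Classical in
/-- Each column has two entries for each of its symbols. -/
lemma IsRowSystem.card_entries {top : Fin S → Fin F} {low : Fin S → Fin K → Fin F}
    (hR : IsRowSystem P top low) (k : Fin K) :
    (Finset.univ.filter fun j => IsCachedRow P k j).card
        + (Finset.univ.filter fun s => k ∈ columnsOf P s).card = F ∧
      (Finset.univ.filter fun j => IsCachedRow P k j).card
        = (Finset.univ.filter fun j => P j k = none).card
          + (Finset.univ.filter fun s => k ∈ columnsOf P s).card := by
  have hlow : ((Finset.univ.filter fun s => k ∈ columnsOf P s).image fun s => low s k).card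
      = (Finset.univ.filter fun s => k ∈ columnsOf P s).card := by
    refine Finset.card_image_of_injOn fun s hs s' hs' h => ?_
    have h1 := hR.low_eq (Finset.mem_filter.1 (Finset.mem_coe.1 hs)).2
    have h2 := hR.low_eq (Finset.mem_filter.1 (Finset.mem_coe.1 hs')).2
    rw [show low s k = low s' k from h, h2] at h1
    exact (Option.some.inj h1).symm
  have htop : ((Finset.univ.filter fun s => k ∈ columnsOf P s).image top).card
      = (Finset.univ.filter fun s => k ∈ columnsOf P s).card := by
    refine Finset.card_image_of_injOn fun s hs s' hs' h => ?_
    have h1 := hR.top_eq (Finset.mem_filter.1 (Finset.mem_coe.1 hs)).2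
    have h2 := hR.top_eq (Finset.mem_filter.1 (Finset.mem_coe.1 hs')).2
    rw [h, h2] at h1
    exact (Option.some.inj h1).symm
  constructor
  · have hcompl : (Finset.univ.filter fun s => k ∈ columnsOf P s).image (fun s => low s k)
        = (Finset.univ.filter fun j => ¬ IsCachedRow P k j) := by
      ext j
      simp [hR.isCachedRow_iff]
    rw [← hlow, hcompl, Finset.card_filter_add_card_filter_not]
    simp
  · rw [← htop, ← Finset.card_union_of_disjoint]
    · congr 1
      ext j
      simp only [Finset.mem_union, Finset.mem_filter, Finset.mem_univ, true_and, Finset.mem_image,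
        IsCachedRow, hR.multi_iff]
      refine or_congr Iff.rfl ⟨?_, ?_⟩
      · rintro ⟨s, h, rfl⟩
        exact ⟨s, mem_columnsOf.2 ⟨_, h⟩, rfl⟩
      · rintro ⟨s, h, rfl⟩
        exact ⟨s, hR.top_eq h, rfl⟩
    · rw [Finset.disjoint_left]
      intro j hj hj'
      obtain ⟨s, hs, rfl⟩ := Finset.mem_image.1 hj'
      have h1 := (Finset.mem_filter.1 hj).2
      rw [hR.top_eq (Finset.mem_filter.1 hs).2] at h1
      cases h1

/-- A secure placement delivery array whose symbols occupy pairwise different sets of columns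
realizes a secure coded caching scheme. -/
theorem IsSPDA.isSecure (h : IsSPDA K F Z S P) (hZ : Z < F)
    (hinj : Function.Injective (columnsOf P)) {N b : ℕ} (hN : 0 < N) (hb : 0 < b) :
    (schemeOf P N).IsSecure b (N * ((F + Z : ℚ) / (2 * F))) := by
  classical
  obtain ⟨top, low, hR⟩ := exists_rowSystem h.four h.sub
  have hF : (0 : ℚ) < F := by exact_mod_cast h.F_pos
  have hNq : (0 : ℚ) < N := by exact_mod_cast hN
  have hslots : ∀ k, Fintype.card ((schemeOf P N).Slots k)
      = (Finset.univ.filter fun s => k ∈ columnsOf P s).card := by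
    intro k
    rw [Fintype.card_subtype]
    rfl
  have hplace : ∀ k, ((schemeOf P N).place k).card
      = N * (Finset.univ.filter fun j => IsCachedRow P k j).card := by
    intro k
    have : (schemeOf P N).place k
        = Finset.univ ×ˢ (Finset.univ.filter fun j => IsCachedRow P k j) := by
      ext p
      rw [mem_place]
      simp
    rw [this, Finset.card_product]
    simp
  -- By `card_entries` each user stores `(F + Z) / 2` rows and has `(F - Z) / 2` keys. Besides `M <
  -- N`, the hypothesis `Z < F` provides each user with a signal, as decoding requires.
  refine ⟨by positivity, ?_, ?_, hinj, ?_, ?_, hR.privacy b, ?_, ?_⟩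
  · have hlt : ((F + Z : ℚ) / (2 * F)) < 1 := by
      rw [div_lt_one (by positivity)]
      have : (Z : ℚ) < F := by exact_mod_cast hZ
      linarith
    nlinarith
  · intro k
    obtain ⟨h1, h2⟩ := hR.card_entries k
    rw [h.stars k] at h2
    have h3 : ((Finset.univ.filter fun j => IsCachedRow P k j).card : ℚ) = (F + Z) / 2 := by
      have : 2 * (Finset.univ.filter fun j => IsCachedRow P k j).card = F + Z := by omega
      have : (2 : ℚ) * (Finset.univ.filter fun j => IsCachedRow P k j).card = F + Z := by
        exact_mod_cast this
      linarith
    rw [hplace, Nat.cast_mul, h3]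
    field_simp
  · intro k
    obtain ⟨h1, h2⟩ := hR.card_entries k
    rw [h.stars k] at h2
    have h3 : 2 * (Finset.univ.filter fun s => k ∈ columnsOf P s).card + Z = F := by omega
    have h4 : (2 : ℚ) * (Finset.univ.filter fun s => k ∈ columnsOf P s).card + Z = F := by
      exact_mod_cast h3
    rw [hslots]
    field_simp
    linarith
  · intro k
    refine hR.decodable b k ?_
    obtain ⟨h1, h2⟩ := hR.card_entries k
    rw [h.stars k] at h2
    obtain ⟨s, hs⟩ := Finset.card_pos.1
      (show 0 < (Finset.univ.filter fun s => k ∈ columnsOf P s).card by omega)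
    exact ⟨s, (Finset.mem_filter.1 hs).2⟩
  · exact (schemeOf P N).perms_secret_of_independent b
  · exact (schemeOf P N).wiretap_of_oneTimePad b

end SchemeOfArray

end SecureCaching

namespace SecureCaching

/-! ### The array of the parallel classes -/

section StackedArray

variable {K F S K' t m : ℕ} {𝒟 : Fin m → Finset (Finset ℕ)}
  {P : Fin F → Fin K → Option (Fin S)}

/-- An array contains each symbol at least four times if the subarrays of its symbols have at least
two columns. -/
lemma HasPattern.four_le {s : Fin S} {g : ℕ} {r : Fin (g + 1) ↪ Fin F} {c : Fin g ↪ Fin K}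
    (h : HasPattern P s g r c) (hg : 2 ≤ g) :
    4 ≤ (Finset.univ.filter fun p : Fin F × Fin K => P p.1 p.2 = some s).card := by
  have hcard : (Finset.univ : Finset (Fin g × Bool)).card = g * 2 := by
    simp
  refine le_trans (show 4 ≤ (Finset.univ : Finset (Fin g × Bool)).card by omega) ?_
  refine Finset.card_le_card_of_injOn (fun q => (r (if q.2 then 0 else q.1.succ), c q.1)) ?_ ?_
  · rintro ⟨l, x⟩ -
    simp only [Finset.coe_filter, Finset.mem_univ, true_and, Set.mem_ofPred_eq]
    rw [h.2.2, pattern, if_pos]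
    cases x <;> simp
  · rintro ⟨l, x⟩ - ⟨l', x'⟩ - hq
    simp only [Prod.mk.injEq, EmbeddingLike.apply_eq_iff_eq] at hq
    obtain ⟨h1, rfl⟩ := hq
    cases x <;> cases x' <;> simp [Fin.succ_ne_zero, (Fin.succ_ne_zero _).symm] at h1 ⊢

lemma card_filter_mem_powersetCard {k : ℕ} (hk : k < K) :
    ((Finset.powersetCard (t + 1) (Finset.range K)).filter fun D => k ∈ D).card
      = (K - 1).choose t := by
  have h1 := Finset.card_filter_add_card_filter_not
    (s := Finset.powersetCard (t + 1) (Finset.range K)) (fun D => k ∈ D)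
  have h2 : (Finset.powersetCard (t + 1) (Finset.range K)).filter (fun D => k ∉ D)
      = Finset.powersetCard (t + 1) ((Finset.range K).erase k) := by
    ext D
    simp only [Finset.mem_filter, Finset.mem_powersetCard, Finset.subset_erase]
    tauto
  rw [h2, Finset.card_powersetCard, Finset.card_powersetCard,
    Finset.card_erase_of_mem (Finset.mem_range.2 hk), Finset.card_range] at h1
  obtain ⟨a, rfl⟩ : ∃ a, K = a + 1 := ⟨K - 1, by omega⟩
  rw [Nat.choose_succ_succ] at h1
  simpa using h1

lemma arrayQ_eq_some_iff {A D : Finset ℕ} {k : ℕ} :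
    arrayQ A k = some D ↔ k ∉ A ∧ A ∪ {k} = D := by
  unfold arrayQ
  split_ifs with h <;> simp [h]

lemma IsParallelClasses.inter_Ico_eq_empty_iff (h𝒟 : IsParallelClasses K' (t + 1) m 𝒟) {i : Fin m}
    {D : Finset ℕ} (hD : D ∈ 𝒟 i) : D ∩ Finset.Ico K K' = ∅ ↔ D ⊆ Finset.range K := by
  have hsub := (Finset.mem_powersetCard.1 (h𝒟.mem i D hD)).1
  rw [← Finset.disjoint_iff_inter_eq_empty, Finset.disjoint_left]
  refine forall_congr' fun x => forall_congr' fun hx => ?_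
  have := Finset.mem_range.1 (hsub hx)
  simp only [Finset.mem_Ico, Finset.mem_range]
  omega

/-- The choice in `arrayQ'` is harmless, since the blocks of a class are disjoint and only one
contains `k`. -/
lemma IsParallelClasses.arrayQ'_eq_some_iff (h𝒟 : IsParallelClasses K' (t + 1) m 𝒟) {i : Fin m}
    {D : Finset ℕ} {k : ℕ} :
    arrayQ' K K' (𝒟 i) k = some D ↔ D ∈ 𝒟 i ∧ k ∈ D ∧ D ⊆ Finset.range K := by
  unfold arrayQ'
  constructor
  · intro h
    split_ifs at h with hex
    obtain rfl := Option.some.inj h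
    obtain ⟨h1, h2, h3⟩ := hex.choose_spec
    exact ⟨h1, h2, (h𝒟.inter_Ico_eq_empty_iff h1).1 h3⟩
  · rintro ⟨h1, h2, h3⟩
    have hex : ∃ D, D ∈ 𝒟 i ∧ k ∈ D ∧ D ∩ Finset.Ico K K' = ∅ :=
      ⟨D, h1, h2, (h𝒟.inter_Ico_eq_empty_iff h1).2 h3⟩
    rw [dif_pos hex]
    obtain ⟨h1', h2', -⟩ := hex.choose_spec
    by_contra hne
    exact Finset.disjoint_left.1 (h𝒟.disjoint i _ h1' _ h1 fun h => hne (congrArg some h)) h2' h2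

lemma IsParallelClasses.mem_of_stackedArray_eq_some (h𝒟 : IsParallelClasses K' (t + 1) m 𝒟)
    {x : Fin m ⊕ {A // A ∈ Finset.powersetCard t (Finset.range K)}} {k : ℕ} (hk : k < K)
    {D : Finset ℕ} (h : stackedArray K K' t 𝒟 x k = some D) :
    D ∈ Finset.powersetCard (t + 1) (Finset.range K) := by
  rcases x with i | A
  · obtain ⟨h1, -, h3⟩ := h𝒟.arrayQ'_eq_some_iff.1 h
    exact Finset.mem_powersetCard.2 ⟨h3, (Finset.mem_powersetCard.1 (h𝒟.mem i D h1)).2⟩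
  · obtain ⟨h1, rfl⟩ := arrayQ_eq_some_iff.1 h
    obtain ⟨hA1, hA2⟩ := Finset.mem_powersetCard.1 A.2
    refine Finset.mem_powersetCard.2 ⟨?_, ?_⟩
    · exact Finset.union_subset hA1 (by simpa using hk)
    · rw [Finset.card_union_of_disjoint (by simpa using h1), hA2, Finset.card_singleton]

/-- The stacked array can be numbered. -/
lemma IsParallelClasses.exists_isNumberingOf (h𝒟 : IsParallelClasses K' (t + 1) m 𝒟) :
    ∃ P : Fin (K.choose t + m) → Fin K → Option (Fin (K.choose (t + 1))),
      IsNumberingOf P K' t 𝒟 := by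
  have he : Fintype.card (Fin (K.choose t + m))
      = Fintype.card (Fin m ⊕ {A // A ∈ Finset.powersetCard t (Finset.range K)}) := by
    simp [add_comm]
  have hf : (Finset.powersetCard (t + 1) (Finset.range K)).card = K.choose (t + 1) := by
    simp
  let e := Fintype.equivOfCardEq he
  let f := (Finset.equivFinOfCardEq hf).symm
  have hex : ∀ (j : Fin (K.choose t + m)) (k : Fin K), ∃ o : Option (Fin (K.choose (t + 1))),
      o.map (fun s => (f s).1) = stackedArray K K' t 𝒟 (e j) k := by
    intro j k
    rcases h : stackedArray K K' t 𝒟 (e j) k with _ | D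
    · exact ⟨none, rfl⟩
    · exact ⟨some (f.symm ⟨D, h𝒟.mem_of_stackedArray_eq_some k.2 h⟩), by simp⟩
  choose P hP using hex
  exact ⟨P, e, f, hP⟩

/-! ### Subarrays of the symbols -/

section Numbering

variable {e : Fin F ≃ Fin m ⊕ {A // A ∈ Finset.powersetCard t (Finset.range K)}}
  {f : Fin S ≃ {D // D ∈ Finset.powersetCard (t + 1) (Finset.range K)}}

lemma eq_some_iff_of_numbering
    (hP : ∀ j k, (P j k).map (fun s => (f s).1) = stackedArray K K' t 𝒟 (e j) k)
    {j : Fin F} {k : Fin K} {s : Fin S} :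
    P j k = some s ↔ stackedArray K K' t 𝒟 (e j) k = some (f s).1 := by
  rw [← hP]
  constructor
  · intro h; rw [h]; rfl
  · intro h
    obtain ⟨s', h1, h2⟩ := Option.map_eq_some_iff.1 h
    rw [h1, f.injective (Subtype.ext h2)]

/-- The group of a symbol is its block; hence groups differ and each user has `(K - 1).choose t`
keys. An occurrence in column `k` is found in the row of the class of the block. -/
lemma mem_columnsOf_of_numbering (h𝒟 : IsParallelClasses K' (t + 1) m 𝒟) (hKK : K ≤ K')
    (hP : ∀ j k, (P j k).map (fun s => (f s).1) = stackedArray K K' t 𝒟 (e j) k)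
    {k : Fin K} {s : Fin S} : k ∈ columnsOf P s ↔ (k : ℕ) ∈ (f s).1 := by
  rw [mem_columnsOf]
  constructor
  · rintro ⟨j, hj⟩
    rw [eq_some_iff_of_numbering hP] at hj
    generalize e j = x at hj
    rcases x with i | A
    · exact (h𝒟.arrayQ'_eq_some_iff.1 hj).2.1
    · rw [← (arrayQ_eq_some_iff.1 hj).2]
      simp
  · intro hk
    obtain ⟨h1, h2⟩ := Finset.mem_powersetCard.1 (f s).2
    obtain ⟨i, hi, -⟩ := h𝒟.partition (f s).1 (Finset.mem_powersetCard.2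
      ⟨h1.trans (Finset.range_mono hKK), h2⟩)
    refine ⟨e.symm (.inl i), (eq_some_iff_of_numbering hP).2 ?_⟩
    rw [Equiv.apply_symm_apply]
    exact h𝒟.arrayQ'_eq_some_iff.2 ⟨hi, hk, h1⟩

/-- The class of `D` is the constant row. In row `D \ {x}` the columns of `D` other than `x` lie in
the row index, hence have stars, which gives the diagonal. -/
lemma hasPattern_of_numbering (h𝒟 : IsParallelClasses K' (t + 1) m 𝒟) (hKK : K ≤ K')
    (hP : ∀ j k, (P j k).map (fun s => (f s).1) = stackedArray K K' t 𝒟 (e j) k) (s : Fin S) :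
    ∃ r c, HasPattern P s (t + 1) r c := by
  obtain ⟨hD1, hD2⟩ := Finset.mem_powersetCard.1 (f s).2
  obtain ⟨i, hi, huniq⟩ := h𝒟.partition (f s).1 (Finset.mem_powersetCard.2
    ⟨hD1.trans (Finset.range_mono hKK), hD2⟩)
  have hcol := fun k => mem_columnsOf_of_numbering h𝒟 hKK hP (k := k) (s := s)
  have hsome := fun j k => eq_some_iff_of_numbering hP (j := j) (k := k) (s := s)
  generalize (f s).1 = D at *
  let o := D.orderEmbOfFin hD2
  have ho : ∀ l, o l ∈ D := D.orderEmbOfFin_mem hD2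
  let c : Fin (t + 1) ↪ Fin K :=
    ⟨fun l => ⟨o l, Finset.mem_range.1 (hD1 (ho l))⟩, fun l l' h =>
      o.injective (congrArg Fin.val h)⟩
  have hc : ∀ k : Fin K, (k : ℕ) ∈ D ↔ ∃ l, c l = k := by
    intro k
    constructor
    · intro hk
      have : (k : ℕ) ∈ Set.range o := by rw [Finset.range_orderEmbOfFin]; exact hk
      obtain ⟨l, hl⟩ := this
      exact ⟨l, Fin.ext hl⟩
    · rintro ⟨l, rfl⟩
      exact ho l
  have hmem : ∀ l, D.erase (o l) ∈ Finset.powersetCard t (Finset.range K) := fun l =>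
    Finset.mem_powersetCard.2 ⟨(Finset.erase_subset _ _).trans hD1, by
      rw [Finset.card_erase_of_mem (ho l), hD2]; rfl⟩
  let r₀ : Fin (t + 1) → Fin F := fun l => e.symm (.inr ⟨D.erase (o l), hmem l⟩)
  have hr₀ : Function.Injective r₀ := by
    intro l l' h
    have h1 : D.erase (o l) = D.erase (o l') :=
      congrArg Subtype.val (Sum.inr.inj (e.symm.injective h))
    have h2 : o l ∉ D.erase (o l') := h1 ▸ Finset.notMem_erase (o l) D
    by_contra hne
    exact h2 (Finset.mem_erase.2 ⟨fun h => hne (o.injective h), ho l⟩)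
  let r : Fin (t + 1 + 1) ↪ Fin F := ⟨Fin.cons (e.symm (.inl i)) r₀,
    Fin.cons_injective_iff.2 ⟨by
      rintro ⟨l, hl⟩
      exact absurd (e.symm.injective hl) (by simp), hr₀⟩⟩
  have hr0 : r 0 = e.symm (.inl i) := rfl
  have hrs : ∀ l, r (Fin.succ l) = r₀ l := fun l => rfl
  have htop : ∀ k : Fin K, (k : ℕ) ∈ D → P (r 0) k = some s := by
    intro k hk
    rw [hsome, hr0, Equiv.apply_symm_apply]
    exact h𝒟.arrayQ'_eq_some_iff.2 ⟨hi, hk, hD1⟩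
  have hlow : ∀ l, P (r (Fin.succ l)) (c l) = some s := by
    intro l
    rw [hsome, hrs, Equiv.apply_symm_apply]
    refine arrayQ_eq_some_iff.2 ⟨Finset.notMem_erase _ _, ?_⟩
    rw [Finset.union_comm, ← Finset.insert_eq]
    exact Finset.insert_erase (ho l)
  refine ⟨r, c, ?_, ?_, ?_⟩
  · intro j
    constructor
    · rintro ⟨x, rfl⟩
      refine Fin.cases ⟨c 0, htop _ (ho 0)⟩ (fun l => ⟨c l, hlow l⟩) x
    · rintro ⟨k, hk⟩
      have hkD := (hcol k).1 (mem_columnsOf.2 ⟨j, hk⟩)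
      rw [hsome] at hk
      rcases hx : e j with i' | A
      · rw [hx] at hk
        have := huniq i' (h𝒟.arrayQ'_eq_some_iff.1 hk).1
        refine ⟨0, ?_⟩
        rw [hr0, ← this, ← hx, Equiv.symm_apply_apply]
      · rw [hx] at hk
        obtain ⟨h1, h2⟩ := arrayQ_eq_some_iff.1 hk
        obtain ⟨l, rfl⟩ := (hc k).1 hkD
        refine ⟨l.succ, ?_⟩
        rw [hrs, Equiv.symm_apply_eq, hx]
        refine congrArg Sum.inr (Subtype.ext ?_)
        change D.erase (o l) = A.1
        rw [← h2, Finset.union_comm, ← Finset.insert_eq]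
        exact Finset.erase_insert h1
  · intro k
    rw [← mem_columnsOf, hcol, hc]
    rfl
  · intro x l
    unfold pattern
    split_ifs with hx
    · rcases hx with rfl | rfl
      · exact htop _ (ho l)
      · exact hlow l
    · obtain ⟨l', rfl⟩ := Fin.exists_succ_eq.2 (fun h => hx (Or.inl h))
      have hne : l ≠ l' := fun h => hx (Or.inr (congrArg Fin.succ h.symm))
      have hst := hP (r l'.succ) (c l)
      rw [hrs, Equiv.apply_symm_apply] at hst
      have hin : ((c l : Fin K) : ℕ) ∈ D.erase (o l') :=
        Finset.mem_erase.2 ⟨fun h => hne (o.injective h), ho l⟩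
      simp only [stackedArray, arrayQ, if_pos hin] at hst
      exact Option.map_eq_none_iff.1 hst

lemma columnsOf_injective_of_numbering (h𝒟 : IsParallelClasses K' (t + 1) m 𝒟) (hKK : K ≤ K')
    (hP : ∀ j k, (P j k).map (fun s => (f s).1) = stackedArray K K' t 𝒟 (e j) k) :
    Function.Injective (columnsOf P) := by
  intro s s' h
  refine f.injective (Subtype.ext (Finset.ext fun x => ?_))
  by_cases hx : x < K
  · have h1 := mem_columnsOf_of_numbering h𝒟 hKK hP (k := ⟨x, hx⟩) (s := s)
    rw [h, mem_columnsOf_of_numbering h𝒟 hKK hP] at h1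
    exact h1.symm
  · have hn : ∀ s, x ∉ (f s).1 := fun s hs =>
      hx (Finset.mem_range.1 ((Finset.mem_powersetCard.1 (f s).2).1 hs))
    exact iff_of_false (hn s) (hn s')

lemma card_symbols_of_numbering (h𝒟 : IsParallelClasses K' (t + 1) m 𝒟) (hKK : K ≤ K')
    (hP : ∀ j k, (P j k).map (fun s => (f s).1) = stackedArray K K' t 𝒟 (e j) k) (k : Fin K) :
    (Finset.univ.filter fun s => k ∈ columnsOf P s).card = (K - 1).choose t := by
  rw [← card_filter_mem_powersetCard (t := t) k.2]
  refine Finset.card_bij (fun s _ => (f s).1) ?_ ?_ ?_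
  · intro s hs
    exact Finset.mem_filter.2 ⟨(f s).2,
      (mem_columnsOf_of_numbering h𝒟 hKK hP).1 (Finset.mem_filter.1 hs).2⟩
  · intro s _ s' _ h
    exact f.injective (Subtype.ext h)
  · intro D hD
    obtain ⟨h1, h2⟩ := Finset.mem_filter.1 hD
    refine ⟨f.symm ⟨D, h1⟩, Finset.mem_filter.2 ⟨Finset.mem_univ _,
      (mem_columnsOf_of_numbering h𝒟 hKK hP).2 ?_⟩, ?_⟩ <;> simp [h2]

end Numbering

/-- The stacked array is a secure placement delivery array. -/
theorem IsParallelClasses.isSPDA (h𝒟 : IsParallelClasses K' (t + 1) m 𝒟) (hK : 0 < K) (ht : 0 < t)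
    (hKK : K ≤ K') {P : Fin (K.choose t + m) → Fin K → Option (Fin S)}
    (hP : IsNumberingOf P K' t 𝒟) (hF : 0 < K.choose t + m) :
    IsSPDA K (K.choose t + m) ((K - 1).choose (t - 1) + m - (K - 1).choose t) S P := by
  classical
  obtain ⟨e, f, hP⟩ := hP
  have hpat := hasPattern_of_numbering h𝒟 hKK hP
  have hfour : ∀ s, 4 ≤ (Finset.univ.filter
      fun p : Fin (K.choose t + m) × Fin K => P p.1 p.2 = some s).card := by
    intro s
    obtain ⟨r, c, h⟩ := hpat s
    exact h.four_le (by omega)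
  have hsub : ∀ s, ∃ g r c, HasPattern P s g r c := fun s => ⟨t + 1, hpat s⟩
  refine ⟨hK, hF, fun k => ?_, hfour, hsub⟩
  -- The stars are what remains of a column after two entries for each of its `(K - 1).choose t`
  -- symbols.
  obtain ⟨top, low, hR⟩ := exists_rowSystem hfour hsub
  obtain ⟨h1, h2⟩ := hR.card_entries k
  have h3 := card_symbols_of_numbering h𝒟 hKK hP k
  have h4 : K.choose t = (K - 1).choose (t - 1) + (K - 1).choose t :=
    Nat.choose_eq_choose_pred_add hK ht
  have h5 : (Finset.univ.filter fun s => k ∈ columnsOf P s).card = (K - 1).choose t := by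
    convert h3
  omega

end StackedArray

end SecureCaching

/-! ### The main theorem -/

theorem mainTheorem5 (K t K' : ℕ) (hK : 0 < K) (ht : 0 < t) (hdvd : ¬ (t + 1) ∣ K)
    (hlarge : t + 1 < K / 2) (hK' : IsLeast {m : ℕ | K < m ∧ (t + 1) ∣ m} K') :
    (∃ 𝒟 : Fin ((K' - 1).choose t) → Finset (Finset ℕ),
      SecureCaching.IsParallelClasses K' (t + 1) ((K' - 1).choose t) 𝒟) ∧
    ∀ 𝒟 : Fin ((K' - 1).choose t) → Finset (Finset ℕ),
      SecureCaching.IsParallelClasses K' (t + 1) ((K' - 1).choose t) 𝒟 →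
      (∃ P : Fin (K.choose t + (K' - 1).choose t) → Fin K → Option (Fin (K.choose (t + 1))),
        SecureCaching.IsNumberingOf P K' t 𝒟) ∧
      ∀ P : Fin (K.choose t + (K' - 1).choose t) → Fin K → Option (Fin (K.choose (t + 1))),
        SecureCaching.IsNumberingOf P K' t 𝒟 →
        SecureCaching.IsSPDA K (K.choose t + (K' - 1).choose t)
          ((K - 1).choose (t - 1) + (K' - 1).choose t - (K - 1).choose t) (K.choose (t + 1)) P ∧
        ∀ N : ℕ, K ≤ N →
          ∃ M : ℚ,
            M / N = (((K - 1).choose (t - 1) : ℚ) + ((K' - 1).choose t : ℚ)) /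
              ((K.choose t : ℚ) + ((K' - 1).choose t : ℚ)) ∧
            (SecureCaching.schemeOf P N).rate =
              (K.choose (t + 1) : ℚ) / ((K.choose t : ℚ) + ((K' - 1).choose t : ℚ)) ∧
            ∀ b : ℕ, 0 < b → (SecureCaching.schemeOf P N).IsSecure b M := by
  obtain ⟨⟨hKK, hdvd'⟩, -⟩ := hK'
  refine ⟨SecureCaching.exists_isParallelClasses (Nat.succ_pos t) (by omega) hdvd',
    fun 𝒟 h𝒟 => ⟨h𝒟.exists_isNumberingOf, fun P hP => ?_⟩⟩
  have hpos : 0 < (K - 1).choose t := Nat.choose_pos (by omega)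
  have hle : (K - 1).choose t ≤ (K' - 1).choose t := Nat.choose_le_choose t (by omega)
  have hpascal : K.choose t = (K - 1).choose (t - 1) + (K - 1).choose t :=
    Nat.choose_eq_choose_pred_add hK ht
  have hS := h𝒟.isSPDA hK ht hKK.le hP (by omega)
  -- Unification with `isSecure` sets `M = N (F + Z) / (2F)`; here `Z < F` because `(K - 1).choose
  -- t` is positive.
  refine ⟨hS, fun N hN => ⟨_, ?_, ?_, fun b hb => hS.isSecure (by omega) ?_ (by omega) hb⟩⟩
  · have hN0 : (N : ℚ) ≠ 0 := by
      have : N ≠ 0 := by omega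
      exact_mod_cast this
    rw [mul_div_cancel_left₀ _ hN0]
    -- This is `F + Z`; the subtraction in `Z` does not truncate, by `hle`, and Pascal's rule
    -- produces the factor 2.
    have hsum : K.choose t + (K' - 1).choose t
        + ((K - 1).choose (t - 1) + (K' - 1).choose t - (K - 1).choose t)
          = 2 * ((K - 1).choose (t - 1) + (K' - 1).choose t) := by omega
    rw [← Nat.cast_add, hsum]
    push_cast
    exact mul_div_mul_left _ _ two_ne_zero
  · simp [SecureCaching.Scheme.rate, div_eq_mul_inv]
  · obtain ⟨e, f, hP⟩ := hP
    exact SecureCaching.columnsOf_injective_of_numbering h𝒟 hKK.le hP
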